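/- Let $S=[0,1]^2$, let $0<\epsilon_1\le\epsilon_2<\infty$, $c_1,c_2>0$ and $\alpha>0$. Let $f$ be a probability density on $S$ with $\epsilon_1\le f(x)\le\epsilon_2$ for all $x\in S$, and let $X_1,X_2,\dots$ be i.i.d. random points of $S$ with density $f$. Let $h:S\times S\to[0,\infty)$ be measurable with $h(x,y)=h(y,x)$ and $c_1\,d(x,y)\le h(x,y)\le c_2\,d(x,y)$ for all $x,y\in S$, where $d$ is the Euclidean distance. Let $MST_n$ be the minimum, over all spanning trees $\mathcal T$ of the complete graph on $X_1,\dots,X_n$, of the total weight $\sum_{(X_i,X_j)\in\mathcal T}h(X_i,X_j)^{\alpha}$. For $A>0$ put $$C_1(A)=\frac{(c_1A)^{\alpha}}{2A^2}\left(1-e^{-\epsilon_1A^2}\right)e^{-8\epsilon_2A^2},\qquad C_2(A)=(2c_2A)^{\alpha}\left(1+\frac{\mathbb E\,T^{\alpha}}{A^2}\right),$$ where $T$ is a geometric random variable, $\mathbb P(T=m)=(1-p)^{m-1}p$ for integers $m\ge1$, with $p=1-e^{-\delta A^2}$, and $\delta=\epsilon_2$ if $\alpha\le1$, $\delta=\epsilon_1$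 if $\alpha>1$. **Theorem.** For every $A>0$ and every integer $k\ge1$ there is $n_0$, depending only on $A,k,\alpha,c_1,c_2,\epsilon_1,\epsilon_2$, such that for all $n\ge n_0$: $$\mathbb P\left(MST_n\ge C_1(A)\,n^{1-\frac{\alpha}{2}}\left(1-\frac{4\sqrt A}{n^{1/4}}\right)\right)\ge1-e^{-n^{1/3}},$$ $$\mathbb P\left(MST_n\le C_2(A)\,n^{1-\frac{\alpha}{2}}\left(1+\frac{2}{n^{1/16}}\right)\right)\ge1-\frac1{n^{2k}},$$ $$C_1^k(A)\left(1-\frac{36k\sqrt A}{n^{1/4}}\right)\le\mathbb E\left(\frac{MST_n^k}{n^{k\left(1-\frac{\alpha}{2}\right)}}\right)\le C_2^k(A)\left(1+\frac{2k}{n^{1/16}}\right).$$ -/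

import Mathlib

open MeasureTheory ProbabilityTheory

/-- The closed unit square in the Euclidean plane. -/
def unitSquare : Set (EuclideanSpace ℝ (Fin 2)) := {x | ∀ i, 0 ≤ x i ∧ x i ≤ 1}

/-- Lebesgue measure (area) on the unit square. -/
noncomputable def squareVolume : Measure unitSquare := Measure.comap Subtype.val volume

open Classical in
/-- The weight of a graph on the vertices `0, …, n - 1`: the sum of the weights `w i j` of its
edges `{i, j}`, each edge being counted once (as the pair with `i < j`). -/
noncomputable def graphWeight {n : ℕ} (w : Fin n → Fin n → ℝ) (T : SimpleGraph (Fin n)) : ℝ :=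
  ∑ i, ∑ j, if i < j ∧ T.Adj i j then w i j else 0

/-- The minimum weight of a spanning tree of the complete graph on the vertices `0, …, n - 1`
with edge weights `w`. For `n ≥ 1` the infimum is over a finite nonempty family. -/
noncomputable def minSpanningTreeWeight {n : ℕ} (w : Fin n → Fin n → ℝ) : ℝ :=
  ⨅ T : {T : SimpleGraph (Fin n) // T.IsTree}, graphWeight w T.1

/-- `MST_n`: the minimum weight of a spanning tree of the complete graph on the first `n` nodes of
the sequence `x`, the edge between the nodes `x i` and `x j` having weight `h (x i) (x j) ^ α`. -/
noncomputable def mst (h : unitSquare → unitSquare → ℝ) (α : ℝ) (x : ℕ → unitSquare) (n : ℕ) : ℝ :=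
  minSpanningTreeWeight fun i j : Fin n => h (x i) (x j) ^ α

/-- The moment `E[T ^ α]` of a geometric random variable `T` with success parameter `p`, that is,
`P(T = m) = (1 - p) ^ (m - 1) * p` for all integers `m ≥ 1` (below, `m = j + 1`). -/
noncomputable def geometricMoment (p α : ℝ) : ℝ :=
  ∑' j : ℕ, (1 - p) ^ j * p * ((j : ℝ) + 1) ^ α

/-- The constant `C₁(A)`. -/
noncomputable def lowerConst (α c₁ ε₁ ε₂ A : ℝ) : ℝ :=
  (c₁ * A) ^ α / (2 * A ^ 2) * (1 - Real.exp (-ε₁ * A ^ 2)) * Real.exp (-8 * ε₂ * A ^ 2)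

/-- The density bound `δ(α)` entering the success parameter of the geometric random variable. -/
noncomputable def densityBound (α ε₁ ε₂ : ℝ) : ℝ := if α ≤ 1 then ε₂ else ε₁

/-- The constant `C₂(A)`. -/
noncomputable def upperConst (α c₂ ε₁ ε₂ A : ℝ) : ℝ :=
  (2 * c₂ * A) ^ α *
    (1 + geometricMoment (1 - Real.exp (-densityBound α ε₁ ε₂ * A ^ 2)) α / A ^ 2)

/-! Both tail bounds come from cutting the square into about `n / A ^ 2` cells of area about `A ^ 2
/ n` and reading off a statistic that depends on the nodes only through their cells. The cells form
a finite type, so measurability and integrability are trivial there. Moving one node changes the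
statistic only near two cells, so McDiarmid's inequality concentrates it around its mean.

Lower bound: call a cell isolated if it is occupied and all its neighbours are empty. Every spanning
tree must leave each isolated cell by an edge that crosses the empty ring, hence of length at least
one cell side (`isolatedCount_sub_one_mul_le_mst`). The mean number of isolated cells is
asymptotically at least twice what `lowerConst` requires. This factor two absorbs the deviation and
the rounding.

Upper bound: build a tree row by row. Each node is joined to an earlier node of its cell, the first
node of a cell to the preceding occupied cell of the row, and the first node of a row to the
preceding row (`mst_le_of_rows`). Crossing `m` empty cells costs `(m + 1) ^ α` units, and writing
this as a telescoping sum over the empty cells turns the mean total cost into the moment of a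
geometric variable by summation by parts. This yields `geometricMoment - 1` in place of
`geometricMoment`, which leaves room for errors. It uses the density bound `ε₁`, which fits the case
`α > 1`. For `α ≤ 1`, where the moment is taken with `ε₂`, each empty cell adds at most one unit, so
the excess is at most the number of cells, and `geometricMoment > 1` is enough.

The slack is a fixed proportion in both cases, so for large `n` the tail bounds hold without their
correction factors. The moments follow by splitting according to these events, with a crude
deterministic bound on the exceptional one. -/

/-! ### Concentration for functions of independent variables on a finite type. -/

section BoundedDifferences

variable {E : Type*} [Finite E] [MeasurableSpace E] [DiscreteMeasurableSpace E]

theorem integral_pi_fin_succ (ν : Measure E) [IsProbabilityMeasure ν] (n : ℕ)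
    (G : (Fin (n + 1) → E) → ℝ) :
    ∫ y, G y ∂(Measure.pi fun _ => ν) =
      ∫ y, ∫ b, G (Fin.cons b y) ∂ν ∂(Measure.pi fun _ : Fin n => ν) := by
  have e := (measurePreserving_piFinSuccAbove (fun _ : Fin (n + 1) => ν) 0).symm
  have h : ∀ (b : E) (y : Fin n → E),
      (MeasurableEquiv.piFinSuccAbove (fun _ => E) 0).symm (b, y) = Fin.cons b y :=
    fun b y => Fin.insertNth_zero' b y
  rw [← e.integral_comp' G, integral_prod_symm _ Integrable.of_finite]
  simp_rw [h]

/-- The bound on the exponential moments of a function with bounded differences of independent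
variables. -/
theorem integral_exp_le_of_bounded_differences (ν : Measure E) [IsProbabilityMeasure ν]
    {c : ℝ} (hc : 0 ≤ c) (t : ℝ) : ∀ (n : ℕ) (F : (Fin n → E) → ℝ),
      (∀ y i b, |F (Function.update y i b) - F y| ≤ c) →
      ∫ y, Real.exp (t * (F y - ∫ z, F z ∂(Measure.pi fun _ => ν))) ∂(Measure.pi fun _ => ν) ≤
        Real.exp (n * (c ^ 2 * t ^ 2 / 2)) := by
  intro n
  induction n with
  | zero =>
    intro F _
    have hF : ∀ y, F y = F default := fun y => by rw [Subsingleton.elim y default]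
    simp [hF]
  | succ n ih =>
    intro F hF
    set G : (Fin n → E) → ℝ := fun y => ∫ b, F (Fin.cons b y) ∂ν with hG
    have hGF : ∫ y, F y ∂(Measure.pi fun _ => ν) = ∫ y, G y ∂(Measure.pi fun _ => ν) :=
      integral_pi_fin_succ ν n F
    -- Averaging out the first coordinate preserves the bounded differences, so the induction
    -- hypothesis applies to `G`.
    have hGd : ∀ y i b, |G (Function.update y i b) - G y| ≤ c := by
      intro y i b
      rw [hG]
      dsimp only
      rw [← integral_sub Integrable.of_finite Integrable.of_finite]
      have := norm_integral_le_of_norm_le_const (μ := ν) (C := c)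
        (f := fun a => F (Fin.cons a (Function.update y i b)) - F (Fin.cons a y))
        (Filter.Eventually.of_forall fun a => by
          rw [Fin.cons_update]
          exact hF _ _ _)
      simpa using this
    rw [integral_pi_fin_succ, hGF]
    set g := ∫ y, G y ∂(Measure.pi fun _ => ν)
    have inner : ∀ y : Fin n → E, ∫ b, Real.exp (t * (F (Fin.cons b y) - g)) ∂ν ≤
        Real.exp (c ^ 2 * t ^ 2 / 2) * Real.exp (t * (G y - g)) := by
      intro y
      obtain ⟨b₀⟩ : Nonempty E := nonempty_of_isProbabilityMeasure ν
      -- Comparison with one fixed value `b₀` puts the slice in an interval of length `2 * c`, and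
      -- Hoeffding's lemma gives variance proxy `c ^ 2`. The sharp constant would need an interval
      -- of length `c`; it is not required.
      have h := (hasSubgaussianMGF_of_mem_Icc (μ := ν) (X := fun b => F (Fin.cons b y))
        (a := F (Fin.cons b₀ y) - c) (b := F (Fin.cons b₀ y) + c)
        (Measurable.of_discrete.aemeasurable) (Filter.Eventually.of_forall fun b => by
          have := hF (Fin.cons b₀ y) 0 b
          rw [Fin.update_cons_zero, abs_le] at this
          constructor <;> linarith)).mgf_le t
      have e1 : ∀ b, Real.exp (t * (F (Fin.cons b y) - g)) =
          Real.exp (t * (F (Fin.cons b y) - G y)) * Real.exp (t * (G y - g)) := by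
        intro b
        rw [← Real.exp_add]
        ring_nf
      simp_rw [e1]
      rw [integral_mul_const]
      refine mul_le_mul_of_nonneg_right (h.trans (le_of_eq ?_)) (Real.exp_pos _).le
      have e2 : F (Fin.cons b₀ y) + c - (F (Fin.cons b₀ y) - c) = 2 * c := by ring
      rw [e2]
      push_cast
      rw [Real.norm_eq_abs, abs_of_nonneg (by positivity : 0 ≤ 2 * c)]
      ring_nf
    calc _ ≤ ∫ y, Real.exp (c ^ 2 * t ^ 2 / 2) * Real.exp (t * (G y - g))
            ∂(Measure.pi fun _ : Fin n => ν) :=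
          integral_mono Integrable.of_finite Integrable.of_finite inner
      _ = Real.exp (c ^ 2 * t ^ 2 / 2) * ∫ y, Real.exp (t * (G y - g))
            ∂(Measure.pi fun _ : Fin n => ν) := integral_const_mul _ _
      _ ≤ Real.exp (c ^ 2 * t ^ 2 / 2) * Real.exp (n * (c ^ 2 * t ^ 2 / 2)) :=
          mul_le_mul_of_nonneg_left (ih G hGd) (Real.exp_pos _).le
      _ = _ := by
          rw [← Real.exp_add]
          push_cast
          ring_nf

variable {Ω : Type*} [MeasurableSpace Ω] {P : Measure Ω} [IsProbabilityMeasure P]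

/-- McDiarmid's bounded differences inequality, for identically distributed variables with values
in a finite type. -/
theorem measureReal_ge_le_of_bounded_differences {n : ℕ} (hn : 0 < n) {Y : Fin n → Ω → E}
    (hY : ∀ i, Measurable (Y i)) (hind : iIndepFun Y P) {ν : Measure E}
    (hν : ∀ i, P.map (Y i) = ν) {F : (Fin n → E) → ℝ} {c : ℝ} (hc : 0 < c)
    (hF : ∀ y i b, |F (Function.update y i b) - F y| ≤ c) {s : ℝ} (hs : 0 ≤ s) :
    P.real {ω | s ≤ F (fun i => Y i ω) - ∫ ω, F (fun i => Y i ω) ∂P} ≤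
      Real.exp (-s ^ 2 / (2 * n * c ^ 2)) := by
  have : IsProbabilityMeasure ν := by
    rw [← hν ⟨0, hn⟩]
    exact Measure.isProbabilityMeasure_map (hY _).aemeasurable
  have hm : Measurable fun ω => (fun i => Y i ω) := measurable_pi_lambda _ hY
  have hlaw : P.map (fun ω => (fun i => Y i ω)) = Measure.pi fun _ => ν := by
    rw [(iIndepFun_iff_map_fun_eq_pi_map fun i => (hY i).aemeasurable).1 hind]
    simp_rw [hν]
  have hint : ∀ G : (Fin n → E) → ℝ,
      ∫ ω, G (fun i => Y i ω) ∂P = ∫ y, G y ∂(Measure.pi fun _ => ν) := by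
    intro G
    rw [← hlaw, integral_map hm.aemeasurable Measurable.of_discrete.aestronglyMeasurable]
  have hn' : (0 : ℝ) < n := by exact_mod_cast hn
  -- The minimiser of the Chernoff exponent `-t * s + n * c ^ 2 * t ^ 2 / 2`.
  set t := s / (n * c ^ 2) with ht
  have ht0 : 0 ≤ t := by positivity
  have hexp : Integrable (fun ω => Real.exp
      (t * (F (fun i => Y i ω) - ∫ ω, F (fun i => Y i ω) ∂P))) P := by
    have : Integrable (fun y => Real.exp (t * (F y - ∫ ω, F (fun i => Y i ω) ∂P)))
      (P.map (fun ω => (fun i => Y i ω))) := Integrable.of_finite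
    exact this.comp_measurable hm
  have h1 := measure_ge_le_exp_mul_mgf s ht0 hexp
  refine h1.trans ?_
  have h2 : mgf (fun ω => F (fun i => Y i ω) - ∫ ω, F (fun i => Y i ω) ∂P) P t ≤
      Real.exp (n * (c ^ 2 * t ^ 2 / 2)) := by
    unfold mgf
    rw [hint (fun y => F y), hint (fun y => Real.exp (t * (F y - _)))]
    exact integral_exp_le_of_bounded_differences ν hc.le t n F hF
  refine (mul_le_mul_of_nonneg_left h2 (Real.exp_pos _).le).trans (le_of_eq ?_)
  rw [← Real.exp_add, ht]
  congr 1
  field_simp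
  ring

end BoundedDifferences

/-- The probability that independent identically distributed variables all avoid a set. -/
theorem measureReal_forall_notMem {E Ω : Type*} [MeasurableSpace E] [DiscreteMeasurableSpace E]
    [MeasurableSpace Ω] {P : Measure Ω} {n : ℕ} {Y : Fin n → Ω → E}
    (hY : ∀ i, Measurable (Y i)) (hind : iIndepFun Y P) {ν : Measure E}
    (hν : ∀ i, P.map (Y i) = ν) [IsProbabilityMeasure ν] (S : Set E) :
    P.real {ω | ∀ i, Y i ω ∉ S} = (1 - ν.real S) ^ n := by
  have h1 : {ω | ∀ i, Y i ω ∉ S} = ⋂ i ∈ Finset.univ, Y i ⁻¹' Sᶜ := by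
    ext ω
    simp
  have h2 := hind.measure_inter_preimage_eq_mul (S := Finset.univ) (sets := fun _ => Sᶜ)
    (fun i _ => MeasurableSet.of_discrete)
  rw [measureReal_def, h1, h2, ENNReal.toReal_prod]
  have h3 : ∀ i, (P (Y i ⁻¹' Sᶜ)).toReal = 1 - ν.real S := by
    intro i
    rw [← Measure.map_apply (hY i) MeasurableSet.of_discrete, hν, ← measureReal_def,
      probReal_compl_eq_one_sub MeasurableSet.of_discrete]
  rw [Finset.prod_congr rfl fun i _ => h3 i]
  simp

/-! ### Deterministic bounds on minimum spanning trees. -/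

section SpanningTrees

variable {n : ℕ} {w : Fin n → Fin n → ℝ}

theorem graphWeight_nonneg (hw : ∀ i j, 0 ≤ w i j) (T : SimpleGraph (Fin n)) :
    0 ≤ graphWeight w T := by
  unfold graphWeight
  refine Finset.sum_nonneg fun i _ => Finset.sum_nonneg fun j _ => ?_
  split_ifs
  exacts [hw i j, le_rfl]

theorem minSpanningTreeWeight_nonneg (hw : ∀ i j, 0 ≤ w i j) : 0 ≤ minSpanningTreeWeight w :=
  Real.iInf_nonneg fun T => graphWeight_nonneg hw T.1

/-- If every vertex other than the root `r` has an edge of weight at most `b v` to a vertex of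
smaller rank, then these edges form a connected graph. -/
theorem minSpanningTreeWeight_le_sum {R : Type*} [Preorder R] [WellFoundedLT R]
    (hw : ∀ i j, 0 ≤ w i j) (hsymm : ∀ i j, w i j = w j i) (r : Fin n) (rank : Fin n → R) (b : Fin n → ℝ) (hb : 0 ≤ b r)
    (H : ∀ v ≠ r, ∃ u, rank u < rank v ∧ w v u ≤ b v) :
    minSpanningTreeWeight w ≤ ∑ v, b v := by
  classical
  have : ∀ v, ∃ u, v ≠ r → rank u < rank v ∧ w v u ≤ b v := fun v => by
    by_cases h : v = r
    · exact ⟨v, fun h' => (h' h).elim⟩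
    · obtain ⟨u, hu⟩ := H v h
      exact ⟨u, fun _ => hu⟩
  choose par hpar using this
  let G : SimpleGraph (Fin n) := SimpleGraph.fromRel fun v u => v ≠ r ∧ u = par v
  have hreach : ∀ v, G.Reachable v r := by
    intro v
    induction hv : rank v using WellFoundedLT.induction generalizing v with
    | ind m ih =>
      by_cases h : v = r
      · rw [h]
      · have h1 := (hpar v h).1
        have hadj : G.Adj v (par v) := by
          rw [SimpleGraph.fromRel_adj]
          refine ⟨fun e => ?_, Or.inl ⟨h, rfl⟩⟩
          rw [← e] at h1
          exact lt_irrefl _ h1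
        exact hadj.reachable.trans (ih _ (hv ▸ h1) _ rfl)
  have : Nonempty (Fin n) := ⟨r⟩
  have hconn : G.Connected :=
    ⟨fun u v => (hreach u).trans (hreach v).symm⟩
  obtain ⟨T, hTG, hT⟩ := hconn.exists_isTree_le
  have hle : minSpanningTreeWeight w ≤ graphWeight w T :=
    ciInf_le ⟨0, by rintro _ ⟨T, rfl⟩; exact graphWeight_nonneg hw T.1⟩
      (⟨T, hT⟩ : {T : SimpleGraph (Fin n) // T.IsTree})
  refine hle.trans ?_
  -- Each edge of `T` joins a vertex to its parent and is charged to that child. The two summands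
  -- separate the edges whose child has the smaller index from those whose child has the larger one.
  calc graphWeight w T
      ≤ ∑ i, ∑ j, ((if i < j ∧ i ≠ r ∧ j = par i then w i j else 0) +
          (if i < j ∧ j ≠ r ∧ i = par j then w j i else 0)) := by
        unfold graphWeight
        refine Finset.sum_le_sum fun i _ => Finset.sum_le_sum fun j _ => ?_
        have h1 := hw i j
        have h2 := hw j i
        by_cases h : i < j ∧ T.Adj i j
        · have h3 := hTG h.2
          rw [SimpleGraph.fromRel_adj] at h3
          rw [if_pos h]
          rcases h3.2 with h4 | h4
          · rw [if_pos ⟨h.1, h4⟩]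
            split_ifs <;> linarith
          · rw [if_pos (⟨h.1, h4⟩ : i < j ∧ j ≠ r ∧ i = par j), hsymm i j]
            split_ifs <;> linarith
        · rw [if_neg h]
          split_ifs <;> linarith
    _ = ∑ i, ∑ j, ((if i < j ∧ i ≠ r ∧ j = par i then w i j else 0) +
          (if j < i ∧ i ≠ r ∧ j = par i then w i j else 0)) := by
        simp_rw [Finset.sum_add_distrib]
        congr 1
        rw [Finset.sum_comm]
    _ ≤ ∑ i, ∑ j, (if j = par i then b i else 0) := by
        refine Finset.sum_le_sum fun i _ => Finset.sum_le_sum fun j _ => ?_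
        by_cases hj : j = par i
        · by_cases hi : i = r
          · simp [hj, hi, hb]
          · have h1 := (hpar i hi).2
            have h2 := (hw i (par i)).trans h1
            subst hj
            rcases lt_trichotomy i (par i) with h | h | h
            · simp [h, hi, h.not_gt, h1]
            · simp [← h, h2]
            · simp [h, hi, h.not_gt, h1]
        · simp [hj]
    _ = ∑ i, b i := by simp

/-- If the vertices in each of the cells of `I` are at cost at least `b` from the vertices in the
other cells, then a spanning tree has at least `#I - 1` edges of cost at least `b`. -/
theorem le_minSpanningTreeWeight {E : Type*} (hw : ∀ i j, 0 ≤ w i j)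
    (hsymm : ∀ i j, w i j = w j i) (hn : 0 < n) (cell : Fin n → E) (I : Finset E)
    (hI : ∀ c ∈ I, ∃ i, cell i = c) {b : ℝ} (hb0 : 0 ≤ b)
    (hb : ∀ i j, cell i ∈ I → cell j ≠ cell i → b ≤ w i j) :
    ((I.card : ℝ) - 1) * b ≤ minSpanningTreeWeight w := by
  classical
  have hne : Nonempty (Fin n) := ⟨⟨0, hn⟩⟩
  have : Nonempty {T : SimpleGraph (Fin n) // T.IsTree} := by
    obtain ⟨T, -, hT⟩ := (SimpleGraph.connected_top (V := Fin n)).exists_isTree_le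
    exact ⟨⟨T, hT⟩⟩
  refine le_ciInf fun ⟨T, hT⟩ => ?_
  dsimp only
  let r : Fin n := ⟨0, hn⟩
  set d : Fin n → ℕ := fun v => T.dist v r with hd
  have closer : ∀ v ≠ r, ∃ u, T.Adj v u ∧ d u < d v := by
    intro v hv
    obtain ⟨p, hp⟩ := hT.1.exists_walk_length_eq_dist v r
    cases p with
    | nil => exact (hv rfl).elim
    | cons h q =>
      refine ⟨_, h, ?_⟩
      have := SimpleGraph.dist_le q
      rw [SimpleGraph.Walk.length_cons] at hp
      simp only [hd]
      omega
  -- In a cell take a vertex at minimal tree distance from the root: its next vertex towards the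
  -- root must lie outside the cell. The cell of the root has to be excluded, whence the `- 1`.
  have exit : ∀ c ∈ I.erase (cell r), ∃ u v, cell u = c ∧ T.Adj u v ∧ d v < d u ∧ cell v ≠ c := by
    intro c hc
    rw [Finset.mem_erase] at hc
    obtain ⟨i, hi⟩ := hI c hc.2
    obtain ⟨u, hu, hmin⟩ := Finset.exists_min_image (Finset.univ.filter fun i => cell i = c) d
      ⟨i, by simp [hi]⟩
    rw [Finset.mem_filter] at hu
    obtain ⟨v, hv, hvd⟩ := closer u (fun e => hc.1 (by rw [← hu.2, e]))
    refine ⟨u, v, hu.2, hv, hvd, fun e => ?_⟩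
    have := hmin v (by simp [e])
    omega
  choose! u v hu huv hdd hv using exit
  -- Orienting edges towards the root attaches each exit edge to its source. Sources in different
  -- cells differ, so the exit edges are counted separately, and no edge of `T` is counted in both
  -- directions.
  set g : Fin n → Fin n → ℝ := fun i j => if T.Adj i j ∧ d j < d i then w i j else 0 with hg
  have hg0 : ∀ i j, 0 ≤ g i j := fun i j => by
    simp only [hg]
    split_ifs
    exacts [hw i j, le_rfl]
  have h1 : ∑ i, ∑ j, g i j ≤ graphWeight w T := by
    calc ∑ i, ∑ j, g i j
        = ∑ i, ∑ j, ((if i < j then g i j else 0) + (if j < i then g i j else 0)) := by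
          refine Finset.sum_congr rfl fun i _ => Finset.sum_congr rfl fun j _ => ?_
          rcases lt_trichotomy i j with h | h | h
          · simp [h, h.not_gt]
          · simp [h, hg]
          · simp [h, h.not_gt]
      _ = ∑ i, ∑ j, ((if i < j then g i j else 0) + (if i < j then g j i else 0)) := by
          simp_rw [Finset.sum_add_distrib]
          congr 1
          rw [Finset.sum_comm]
      _ ≤ graphWeight w T := by
          unfold graphWeight
          refine Finset.sum_le_sum fun i _ => Finset.sum_le_sum fun j _ => ?_
          have h0 := hw i j
          simp only [hg, hsymm j i, T.adj_comm j i]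
          split_ifs <;> first | omega | grind
  refine le_trans ?_ h1
  calc ((I.card : ℝ) - 1) * b ≤ ((I.erase (cell r)).card : ℝ) * b := by
        refine mul_le_mul_of_nonneg_right ?_ hb0
        have := Finset.pred_card_le_card_erase (s := I) (a := cell r)
        have : I.card ≤ (I.erase (cell r)).card + 1 := by omega
        have : (I.card : ℝ) ≤ (I.erase (cell r)).card + 1 := by exact_mod_cast this
        linarith
    _ = ∑ c ∈ I.erase (cell r), b := by simp
    _ ≤ ∑ c ∈ I.erase (cell r), ∑ j, g (u c) j := by
        refine Finset.sum_le_sum fun c hc => ?_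
        refine le_trans ?_ (Finset.single_le_sum (fun j _ => hg0 (u c) j) (Finset.mem_univ (v c)))
        simp only [hg]
        rw [if_pos ⟨huv c hc, hdd c hc⟩]
        refine hb _ _ ?_ ?_
        · rw [hu c hc]
          exact Finset.mem_of_mem_erase hc
        · rw [hu c hc]
          exact hv c hc
    _ = ∑ i ∈ (I.erase (cell r)).image u, ∑ j, g i j := by
        rw [Finset.sum_image]
        intro c hc c' hc' e
        rw [← hu c hc, ← hu c' hc', e]
    _ ≤ ∑ i, ∑ j, g i j :=
        Finset.sum_le_sum_of_subset_of_nonneg (Finset.subset_univ _)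
          fun i _ _ => Finset.sum_nonneg fun j _ => hg0 i j

end SpanningTrees

/-! ### Grids on the unit square. -/

section Grid

/-- The index of the interval containing `t` when `[0, 1]` is cut into `m` equal intervals. -/
noncomputable def gridIndex (m : ℕ) [NeZero m] (t : ℝ) : Fin m :=
  ⟨min ⌊m * t⌋₊ (m - 1), by have := NeZero.pos m; omega⟩

theorem gridIndex_le {m : ℕ} [NeZero m] {t : ℝ} (h0 : 0 ≤ t) :
    ((gridIndex m t : ℕ) : ℝ) / m ≤ t := by
  have hm : (0 : ℝ) < m := by exact_mod_cast NeZero.pos m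
  rw [div_le_iff₀ hm, mul_comm]
  refine le_trans ?_ (Nat.floor_le (by positivity : 0 ≤ (m : ℝ) * t))
  exact_mod_cast min_le_left _ _

theorem le_gridIndex_add_one {m : ℕ} [NeZero m] {t : ℝ} (h1 : t ≤ 1) :
    t ≤ ((gridIndex m t : ℕ) + 1 : ℝ) / m := by
  have hm0 := NeZero.pos m
  have hm : (0 : ℝ) < m := by exact_mod_cast hm0
  rw [le_div_iff₀ hm, mul_comm]
  simp only [gridIndex]
  rcases le_total ⌊(m : ℝ) * t⌋₊ (m - 1) with h | h
  · rw [min_eq_left h]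
    exact (Nat.lt_floor_add_one _).le
  -- The truncated case covers `t = 1`, which is put into the last interval.
  · rw [min_eq_right h, Nat.cast_sub hm0]
    push_cast
    nlinarith

theorem gridIndex_eq {m : ℕ} [NeZero m] {t : ℝ} {j : Fin m} (h0 : ((j : ℕ) : ℝ) / m ≤ t)
    (h1 : t < ((j : ℕ) + 1 : ℝ) / m) : gridIndex m t = j := by
  have hm : (0 : ℝ) < m := by exact_mod_cast NeZero.pos m
  rw [div_le_iff₀ hm] at h0
  rw [lt_div_iff₀ hm] at h1
  have hfl : ⌊(m : ℝ) * t⌋₊ = j := by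
    rw [Nat.floor_eq_iff (by rw [mul_comm]; exact le_trans (by positivity) h0), mul_comm]
    exact ⟨h0, h1⟩
  ext
  simp only [gridIndex]
  rw [hfl]
  have := j.2
  omega

theorem measurable_gridIndex (m : ℕ) [NeZero m] : Measurable (gridIndex m) := by
  have h : Measurable fun t : ℝ => ⌊(m : ℝ) * t⌋₊ := Nat.measurable_floor.comp (by fun_prop)
  have h2 : gridIndex m = (fun k : ℕ => (⟨min k (m - 1), by have := NeZero.pos m; omega⟩ : Fin m)) ∘
    fun t : ℝ => ⌊(m : ℝ) * t⌋₊ := rfl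
  rw [h2]
  exact Measurable.of_discrete.comp h

theorem abs_sub_le_of_gridIndex {m : ℕ} [NeZero m] {s t : ℝ} (hs : 0 ≤ s ∧ s ≤ 1)
    (ht : 0 ≤ t ∧ t ≤ 1) {d : ℕ} (h1 : (gridIndex m s : ℕ) ≤ gridIndex m t + d)
    (h2 : (gridIndex m t : ℕ) ≤ gridIndex m s + d) : |s - t| ≤ (d + 1 : ℝ) / m := by
  have hm : (0 : ℝ) < m := by exact_mod_cast NeZero.pos m
  have a1 := gridIndex_le (m := m) hs.1
  have a2 := gridIndex_le (m := m) ht.1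
  have a3 := le_gridIndex_add_one (m := m) hs.2
  have a4 := le_gridIndex_add_one (m := m) ht.2
  have h1' : ((gridIndex m s : ℕ) : ℝ) ≤ (gridIndex m t : ℕ) + d := by exact_mod_cast h1
  have h2' : ((gridIndex m t : ℕ) : ℝ) ≤ (gridIndex m s : ℕ) + d := by exact_mod_cast h2
  rw [div_le_iff₀ hm] at a1 a2
  rw [le_div_iff₀ hm] at a3 a4
  rw [abs_le, neg_le, neg_sub, le_div_iff₀ hm, le_div_iff₀ hm]
  constructor <;> nlinarith

theorem le_abs_sub_of_gridIndex {m : ℕ} [NeZero m] {s t : ℝ} (hs : s ≤ 1) (ht : 0 ≤ t)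
    (h : (gridIndex m s : ℕ) + 2 ≤ gridIndex m t) : 1 / (m : ℝ) ≤ t - s := by
  have hm : (0 : ℝ) < m := by exact_mod_cast NeZero.pos m
  have a2 := gridIndex_le (m := m) ht
  have a3 := le_gridIndex_add_one (m := m) hs
  have h' : ((gridIndex m s : ℕ) : ℝ) + 2 ≤ (gridIndex m t : ℕ) := by exact_mod_cast h
  rw [div_le_iff₀ hm] at a2
  rw [le_div_iff₀ hm] at a3
  rw [div_le_iff₀ hm]
  nlinarith

/-- The cell (row and column) of a point when the unit square is cut into `a` rows and `b`
columns. -/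
noncomputable def gridCell (a b : ℕ) [NeZero a] [NeZero b] (x : unitSquare) : Fin a × Fin b :=
  (gridIndex a (x.1 1), gridIndex b (x.1 0))

variable {a b : ℕ} [NeZero a] [NeZero b]

theorem measurable_gridCell : Measurable (gridCell a b) := by
  unfold gridCell
  refine Measurable.prodMk ((measurable_gridIndex a).comp ?_) ((measurable_gridIndex b).comp ?_) <;>
  fun_prop

theorem measurableSet_unitSquare : MeasurableSet unitSquare := by
  have h : unitSquare = ⋂ i, {x : EuclideanSpace ℝ (Fin 2) | 0 ≤ x i} ∩ {x | x i ≤ 1} := by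
    ext x
    simp [unitSquare]
  rw [h]
  exact MeasurableSet.iInter fun i => (measurableSet_le (by fun_prop) (by fun_prop)).inter
    (measurableSet_le (by fun_prop) (by fun_prop))

/-- The cell lies between a half-open and a closed rectangle with the same corners, which have equal
area. The boundary therefore needs no separate treatment. -/
theorem squareVolume_gridCell_preimage (c : Fin a × Fin b) :
    squareVolume (gridCell a b ⁻¹' {c}) = ENNReal.ofReal (1 / (a * b)) := by
  have ha : (0 : ℝ) < a := by exact_mod_cast NeZero.pos a
  have hb : (0 : ℝ) < b := by exact_mod_cast NeZero.pos b
  set lo : Fin 2 → ℝ := ![(c.2 : ℕ) / b, (c.1 : ℕ) / a] with hlo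
  set hi : Fin 2 → ℝ := ![((c.2 : ℕ) + 1) / b, ((c.1 : ℕ) + 1) / a] with hhi
  have hprod : ∏ i, ENNReal.ofReal (hi i - lo i) = ENNReal.ofReal (1 / (a * b)) := by
    rw [Fin.prod_univ_two, ← ENNReal.ofReal_mul]
    · congr 1
      simp only [hlo, hhi, Matrix.cons_val_zero, Matrix.cons_val_one]
      field_simp
      ring
    · simp only [hlo, hhi, Matrix.cons_val_zero]
      rw [← sub_div]
      exact div_nonneg (by linarith) hb.le
  have hsq : squareVolume (gridCell a b ⁻¹' {c}) =
      volume ((Subtype.val : unitSquare → EuclideanSpace ℝ (Fin 2)) '' (gridCell a b ⁻¹' {c})) :=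
    (MeasurableEmbedding.subtype_coe measurableSet_unitSquare).comap_apply _ _
  have hvol : ∀ S : Set (Fin 2 → ℝ), MeasurableSet S →
      volume ((WithLp.ofLp : EuclideanSpace ℝ (Fin 2) → Fin 2 → ℝ) ⁻¹' S) = volume S := fun S hS =>
    (PiLp.volume_preserving_ofLp (Fin 2)).measure_preimage hS.nullMeasurableSet
  rw [hsq]
  refine le_antisymm ?_ ?_
  · rw [← hprod, ← Real.volume_Icc_pi, ← hvol _ measurableSet_Icc]
    refine measure_mono ?_
    rintro _ ⟨x, hx, rfl⟩
    have hx' : gridCell a b x = c := hx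
    simp only [Set.mem_preimage, Set.mem_Icc, Pi.le_def, Fin.forall_fin_two]
    simp only [hlo, hhi, ← hx', gridCell, Matrix.cons_val_zero, Matrix.cons_val_one]
    exact ⟨⟨gridIndex_le (x.2 0).1, gridIndex_le (x.2 1).1⟩,
      ⟨le_gridIndex_add_one (x.2 0).2, le_gridIndex_add_one (x.2 1).2⟩⟩
  · rw [← hprod, ← Real.volume_pi_Ico,
      ← hvol _ (MeasurableSet.univ_pi fun _ => measurableSet_Ico)]
    refine measure_mono ?_
    intro x hx
    simp only [Set.mem_preimage, Set.mem_pi, Set.mem_univ, forall_true_left, Set.mem_Ico,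
      Fin.forall_fin_two, hlo, hhi, Matrix.cons_val_zero, Matrix.cons_val_one] at hx
    have hc1 : ((c.1 : ℕ) + 1 : ℝ) ≤ a := by exact_mod_cast c.1.2
    have hc2 : ((c.2 : ℕ) + 1 : ℝ) ≤ b := by exact_mod_cast c.2.2
    have h0 : ((c.1 : ℕ) + 1 : ℝ) / a ≤ 1 := by rwa [div_le_one ha]
    have h1 : ((c.2 : ℕ) + 1 : ℝ) / b ≤ 1 := by rwa [div_le_one hb]
    have h2 : (0 : ℝ) ≤ (c.1 : ℕ) / a := by positivity
    have h3 : (0 : ℝ) ≤ (c.2 : ℕ) / b := by positivity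
    have hxs : x ∈ unitSquare := by
      intro i
      fin_cases i
      · exact ⟨h3.trans hx.1.1, hx.1.2.le.trans h1⟩
      · exact ⟨h2.trans hx.2.1, hx.2.2.le.trans h0⟩
    refine ⟨⟨x, hxs⟩, ?_, rfl⟩
    exact Prod.ext (gridIndex_eq hx.2.1 hx.2.2) (gridIndex_eq hx.1.1 hx.1.2)

theorem gridCell_law_bounds {f : unitSquare → ℝ} {ε₁ ε₂ : ℝ} (hε : 0 < ε₁)
    (hf : ∀ x, ε₁ ≤ f x ∧ f x ≤ ε₂) (c : Fin a × Fin b) :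
    ε₁ / (a * b) ≤ ((squareVolume.withDensity fun x => ENNReal.ofReal (f x)).map
        (gridCell a b)).real {c} ∧
      ((squareVolume.withDensity fun x => ENNReal.ofReal (f x)).map
        (gridCell a b)).real {c} ≤ ε₂ / (a * b) := by
  have ha : (0 : ℝ) < a := by exact_mod_cast NeZero.pos a
  have hb : (0 : ℝ) < b := by exact_mod_cast NeZero.pos b
  have hm : MeasurableSet (gridCell a b ⁻¹' {c}) := measurable_gridCell (measurableSet_singleton c)
  have hε₂ : 0 ≤ ε₂ := by
    have x : unitSquare := ⟨0, fun i => by simp⟩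
    have := hf x
    linarith
  have key : ∀ r : ℝ, 0 ≤ r → ENNReal.ofReal (r / (a * b)) =
      ∫⁻ _ in gridCell a b ⁻¹' {c}, ENNReal.ofReal r ∂squareVolume := by
    intro r hr
    rw [setLIntegral_const, squareVolume_gridCell_preimage, ← ENNReal.ofReal_mul hr,
      mul_one_div]
  rw [measureReal_def, Measure.map_apply measurable_gridCell (measurableSet_singleton c),
    withDensity_apply _ hm]
  have h2 : ∫⁻ x in gridCell a b ⁻¹' {c}, ENNReal.ofReal (f x) ∂squareVolume ≤
      ENNReal.ofReal (ε₂ / (a * b)) := by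
    rw [key _ hε₂]
    exact lintegral_mono fun x => ENNReal.ofReal_le_ofReal (hf x).2
  have h1 : ENNReal.ofReal (ε₁ / (a * b)) ≤
      ∫⁻ x in gridCell a b ⁻¹' {c}, ENNReal.ofReal (f x) ∂squareVolume := by
    rw [key _ hε.le]
    exact lintegral_mono fun x => ENNReal.ofReal_le_ofReal (hf x).1
  have hfin : ∫⁻ x in gridCell a b ⁻¹' {c}, ENNReal.ofReal (f x) ∂squareVolume ≠ ⊤ :=
    (h2.trans_lt ENNReal.ofReal_lt_top).ne
  exact ⟨(ENNReal.ofReal_le_iff_le_toReal hfin).1 h1,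
    ENNReal.toReal_le_of_le_ofReal (by positivity) h2⟩

theorem dist_sq_unitSquare (x y : unitSquare) :
    dist x y ^ 2 = (x.1 0 - y.1 0) ^ 2 + (x.1 1 - y.1 1) ^ 2 := by
  rw [Subtype.dist_eq, EuclideanSpace.dist_eq, Real.sq_sqrt (by positivity), Fin.sum_univ_two]
  simp [Real.dist_eq]

theorem abs_sub_le_dist_unitSquare (x y : unitSquare) (i : Fin 2) :
    |x.1 i - y.1 i| ≤ dist x y := by
  refine abs_le_of_sq_le_sq ?_ dist_nonneg
  rw [dist_sq_unitSquare]
  fin_cases i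
  · simp; positivity
  · simp; positivity

theorem dist_unitSquare_le_two (x y : unitSquare) : dist x y ≤ 2 := by
  refine le_of_sq_le_sq ?_ (by norm_num)
  rw [dist_sq_unitSquare]
  have h0 := x.2 0
  have h1 := x.2 1
  have h2 := y.2 0
  have h3 := y.2 1
  nlinarith

/-- Points whose cells are neither equal nor adjacent are far apart. -/
theorem le_dist_of_gridCell {K : ℕ} [NeZero K] {x y : unitSquare}
    (h : ¬ (((gridCell K K x).1 : ℕ) ≤ (gridCell K K y).1 + 1 ∧
      ((gridCell K K y).1 : ℕ) ≤ (gridCell K K x).1 + 1 ∧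
      ((gridCell K K x).2 : ℕ) ≤ (gridCell K K y).2 + 1 ∧
      ((gridCell K K y).2 : ℕ) ≤ (gridCell K K x).2 + 1)) :
    1 / (K : ℝ) ≤ dist x y := by
  have key : ∀ i : Fin 2, (gridIndex K (x.1 i) : ℕ) + 2 ≤ gridIndex K (y.1 i) ∨
      (gridIndex K (y.1 i) : ℕ) + 2 ≤ gridIndex K (x.1 i) → 1 / (K : ℝ) ≤ dist x y := by
    intro i hi
    refine le_trans ?_ (abs_sub_le_dist_unitSquare x y i)
    rcases hi with hi | hi
    · rw [abs_sub_comm]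
      exact (le_abs_sub_of_gridIndex (x.2 i).2 (y.2 i).1 hi).trans (le_abs_self _)
    · exact (le_abs_sub_of_gridIndex (y.2 i).2 (x.2 i).1 hi).trans (le_abs_self _)
  simp only [gridCell] at h
  by_cases h0 : (gridIndex K (x.1 0) : ℕ) + 2 ≤ gridIndex K (y.1 0) ∨
      (gridIndex K (y.1 0) : ℕ) + 2 ≤ gridIndex K (x.1 0)
  · exact key 0 h0
  · exact key 1 (by omega)

theorem dist_sq_le_of_gridCell {x y : unitSquare} {d e : ℕ}
    (h1 : ((gridCell a b x).1 : ℕ) ≤ (gridCell a b y).1 + d)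
    (h2 : ((gridCell a b y).1 : ℕ) ≤ (gridCell a b x).1 + d)
    (h3 : ((gridCell a b x).2 : ℕ) ≤ (gridCell a b y).2 + e)
    (h4 : ((gridCell a b y).2 : ℕ) ≤ (gridCell a b x).2 + e) :
    dist x y ^ 2 ≤ ((e + 1 : ℝ) / b) ^ 2 + ((d + 1 : ℝ) / a) ^ 2 := by
  rw [dist_sq_unitSquare]
  have k0 := abs_sub_le_of_gridIndex (x.2 0) (y.2 0) h3 h4
  have k1 := abs_sub_le_of_gridIndex (x.2 1) (y.2 1) h1 h2
  have := sq_le_sq' (by have := abs_nonneg (x.1 0 - y.1 0); linarith) k0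
  have := sq_le_sq' (by have := abs_nonneg (x.1 1 - y.1 1); linarith) k1
  simp only [sq_abs] at *
  linarith

end Grid

/-! ### Sums of local functions of a configuration. -/

section LocalSums

/-- A sum of local functions of a configuration has bounded differences. -/
theorem abs_sum_update_sub_le {E ι : Type*} [Fintype ι] [DecidableEq ι] {n : ℕ}
    (ψ : ι → (Fin n → E) → ℝ) {B : ℝ} (hB0 : 0 ≤ B) (hB : ∀ c y, 0 ≤ ψ c y ∧ ψ c y ≤ B) (nb : E → Finset ι)
    {D : ℕ} (hD : ∀ e, (nb e).card ≤ D)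
    (hloc : ∀ c y i b, c ∉ nb (y i) → c ∉ nb b → ψ c (Function.update y i b) = ψ c y)
    (y : Fin n → E) (i : Fin n) (b : E) :
    |∑ c, ψ c (Function.update y i b) - ∑ c, ψ c y| ≤ 2 * D * B := by
  rw [← Finset.sum_sub_distrib]
  refine (Finset.abs_sum_le_sum_abs _ _).trans ?_
  calc ∑ c, |ψ c (Function.update y i b) - ψ c y|
      ≤ ∑ c, if c ∈ nb (y i) ∪ nb b then B else 0 := by
        refine Finset.sum_le_sum fun c _ => ?_
        split_ifs with h
        · have h1 := hB c y
          have h2 := hB c (Function.update y i b)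
          rw [abs_le]
          constructor <;> linarith
        · rw [Finset.mem_union, not_or] at h
          rw [hloc c y i b h.1 h.2, sub_self, abs_zero]
    _ = ((nb (y i) ∪ nb b).card : ℝ) * B := by
        rw [← Finset.sum_filter, Finset.sum_const, nsmul_eq_mul]
        congr 3
        ext c
        simp
    _ ≤ 2 * D * B := by
        refine mul_le_mul_of_nonneg_right ?_ hB0
        have h1 := Finset.card_union_le (nb (y i)) (nb b)
        have h2 := hD (y i)
        have h3 := hD b
        have : (nb (y i) ∪ nb b).card ≤ 2 * D := by omega
        exact_mod_cast this

theorem card_filter_fin_le {m : ℕ} (i : ℕ) (p q : ℕ) :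
    (Finset.univ.filter fun j : Fin m => (j : ℕ) ≤ i + p ∧ i ≤ j + q).card ≤ p + q + 1 := by
  calc _ ≤ (Finset.Icc (i - q) (i + p)).card := by
        refine Finset.card_le_card_of_injOn (fun j : Fin m => (j : ℕ)) ?_ ?_
        · intro j hj
          simp only [Finset.coe_filter, Finset.mem_univ, true_and, Set.mem_ofPred_eq] at hj
          simp only [Finset.coe_Icc, Set.mem_Icc]
          omega
        · intro j _ j' _ h
          exact Fin.ext h
    _ ≤ p + q + 1 := by
        rw [Nat.card_Icc]
        omega

theorem measureReal_finset_bounds {E : Type*} [MeasurableSpace E] [MeasurableSingletonClass E]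
    {ν : Measure E} [IsFiniteMeasure ν] {lo hi : ℝ} (hν : ∀ c, lo ≤ ν.real {c} ∧ ν.real {c} ≤ hi)
    (S : Finset E) : S.card * lo ≤ ν.real (S : Set E) ∧ ν.real (S : Set E) ≤ S.card * hi := by
  rw [← sum_measureReal_singleton, ← nsmul_eq_mul, ← nsmul_eq_mul, ← Finset.sum_const,
    ← Finset.sum_const]
  exact ⟨Finset.sum_le_sum fun c _ => (hν c).1, Finset.sum_le_sum fun c _ => (hν c).2⟩

end LocalSums

/-! ### The number of isolated cells. -/

section IsolatedCells

/-- The cells of the `K × K` grid that are equal or adjacent to `c`. -/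
def cellNeighbours {K : ℕ} (c : Fin K × Fin K) : Finset (Fin K × Fin K) :=
  Finset.univ.filter fun e => (c.1 : ℕ) ≤ e.1 + 1 ∧ (e.1 : ℕ) ≤ c.1 + 1 ∧
    (c.2 : ℕ) ≤ e.2 + 1 ∧ (e.2 : ℕ) ≤ c.2 + 1

theorem mem_cellNeighbours_comm {K : ℕ} {c e : Fin K × Fin K} :
    c ∈ cellNeighbours e ↔ e ∈ cellNeighbours c := by
  simp only [cellNeighbours, Finset.mem_filter, Finset.mem_univ, true_and]
  tauto

theorem self_mem_cellNeighbours {K : ℕ} (c : Fin K × Fin K) : c ∈ cellNeighbours c := by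
  simp [cellNeighbours]

theorem card_cellNeighbours_le {K : ℕ} (c : Fin K × Fin K) : (cellNeighbours c).card ≤ 9 := by
  calc _ ≤ ((Finset.univ.filter fun j : Fin K => (j : ℕ) ≤ c.1 + 1 ∧ (c.1 : ℕ) ≤ j + 1) ×ˢ
        (Finset.univ.filter fun j : Fin K => (j : ℕ) ≤ c.2 + 1 ∧ (c.2 : ℕ) ≤ j + 1)).card := by
        refine Finset.card_le_card fun e he => ?_
        simp only [cellNeighbours, Finset.mem_filter, Finset.mem_univ, true_and] at he
        simp only [Finset.mem_product, Finset.mem_filter, Finset.mem_univ, true_and]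
        tauto
    _ ≤ 3 * 3 := by
        rw [Finset.card_product]
        exact Nat.mul_le_mul (card_filter_fin_le _ 1 1) (card_filter_fin_le _ 1 1)

/-- The cell `c` is occupied and its neighbours are empty. -/
def IsIsolated {K n : ℕ} (y : Fin n → Fin K × Fin K) (c : Fin K × Fin K) : Prop :=
  (∃ i, y i = c) ∧ ∀ i, y i ∈ cellNeighbours c → y i = c

/-- Isolation of `c` is decided by the nodes in the neighbourhood of `c` alone. The moved node is
outside it both before and after. -/
theorem isIsolated_update_iff {K n : ℕ} (y : Fin n → Fin K × Fin K) (i : Fin n)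
    (b c : Fin K × Fin K) (h1 : c ∉ cellNeighbours (y i)) (h2 : c ∉ cellNeighbours b) :
    IsIsolated (Function.update y i b) c ↔ IsIsolated y c := by
  rw [mem_cellNeighbours_comm] at h1 h2
  have hc := self_mem_cellNeighbours c
  unfold IsIsolated
  simp only [Function.update_apply]
  constructor
  · rintro ⟨⟨j, hj⟩, h⟩
    have hji : j ≠ i := by rintro rfl; simp at hj; exact h2 (hj ▸ hc)
    refine ⟨⟨j, by simpa [hji] using hj⟩, fun l hl => ?_⟩
    have hli : l ≠ i := by rintro rfl; exact h1 hl
    have := h l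
    simp only [hli, if_false] at this
    exact this hl
  · rintro ⟨⟨j, hj⟩, h⟩
    have hji : j ≠ i := by rintro rfl; exact h1 (hj ▸ hc)
    refine ⟨⟨j, by simpa [hji] using hj⟩, fun l hl => ?_⟩
    by_cases hli : l = i
    · simp only [hli, if_true] at hl
      exact (h2 hl).elim
    · simp only [hli, if_false] at hl ⊢
      exact h l hl

open Classical in
/-- The number of isolated cells. -/
noncomputable def isolatedCount {K n : ℕ} (y : Fin n → Fin K × Fin K) : ℝ :=
  ∑ c, if IsIsolated y c then 1 else 0

/-- Moving a node affects at most nine cells around its old position and nine around its new one. -/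
theorem abs_isolatedCount_update_sub_le {K n : ℕ} (y : Fin n → Fin K × Fin K) (i : Fin n)
    (b : Fin K × Fin K) :
    |isolatedCount (Function.update y i b) - isolatedCount y| ≤ 18 := by
  classical
  refine (abs_sum_update_sub_le (fun c y => if IsIsolated y c then (1 : ℝ) else 0) zero_le_one
    (fun c y => by split_ifs <;> norm_num) cellNeighbours (D := 9) card_cellNeighbours_le
    (fun c y i b h1 h2 => ?_) y i b).trans (by norm_num)
  simp only [isIsolated_update_iff y i b c h1 h2]

variable {Ω : Type*} [MeasurableSpace Ω] {P : Measure Ω} [IsProbabilityMeasure P] {n K : ℕ}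
  {Y : Fin n → Ω → Fin K × Fin K} {ν : Measure (Fin K × Fin K)}

/-- Let `p` be the mass of `c` and `q` that of its ring of neighbours. The event is "ring empty"
without "ring and `c` empty", so it has probability `(1 - q) ^ n - (1 - (p + q)) ^ n`, and `1 - (p +
q) ≤ (1 - q) * (1 - p)` gives a product bound. Cells on the boundary have a smaller ring, which only
helps. -/
theorem measureReal_isIsolated_ge (hY : ∀ i, Measurable (Y i)) (hind : iIndepFun Y P)
    (hν : ∀ i, P.map (Y i) = ν) [IsProbabilityMeasure ν] {lo hi : ℝ} (hlo : 0 ≤ lo)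
    (hb : ∀ c, lo ≤ ν.real {c} ∧ ν.real {c} ≤ hi) (hhi : 8 * hi ≤ 1) (c : Fin K × Fin K) :
    (1 - 8 * hi) ^ n * (1 - Real.exp (-(n * lo))) ≤
      P.real {ω | IsIsolated (fun i => Y i ω) c} := by
  set S : Finset (Fin K × Fin K) := (cellNeighbours c).erase c with hS
  have hins : insert c S = cellNeighbours c := Finset.insert_erase (self_mem_cellNeighbours c)
  have hmeas : ∀ T : Set (Fin K × Fin K), MeasurableSet {ω | ∀ i, Y i ω ∉ T} := fun T => by
    have : {ω | ∀ i, Y i ω ∉ T} = ⋂ i, Y i ⁻¹' Tᶜ := by ext; simp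
    rw [this]
    exact MeasurableSet.iInter fun i => hY i MeasurableSet.of_discrete
  have hset : {ω | IsIsolated (fun i => Y i ω) c} =
      {ω | ∀ i, Y i ω ∉ (S : Set (Fin K × Fin K))} \
        {ω | ∀ i, Y i ω ∉ ((insert c S : Finset _) : Set (Fin K × Fin K))} := by
    ext ω
    simp only [IsIsolated, Set.mem_ofPred_eq, Set.mem_sdiff, Finset.mem_coe, hins]
    have hc := self_mem_cellNeighbours c
    simp only [hS, Finset.mem_erase, not_and', not_not, not_forall]
    constructor
    · rintro ⟨⟨i, hi⟩, h⟩
      exact ⟨h, i, hi ▸ hc⟩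
    · rintro ⟨h, i, hi⟩
      exact ⟨⟨i, h i hi⟩, h⟩
  have hsub : {ω | ∀ i, Y i ω ∉ ((insert c S : Finset _) : Set (Fin K × Fin K))} ⊆
      {ω | ∀ i, Y i ω ∉ (S : Set (Fin K × Fin K))} := fun ω hω i hi =>
    hω i (Finset.mem_coe.2 (Finset.mem_insert_of_mem hi))
  rw [hset, measureReal_sdiff hsub (hmeas _), measureReal_forall_notMem hY hind hν,
    measureReal_forall_notMem hY hind hν]
  have hcard : S.card ≤ 8 := by
    rw [hS, Finset.card_erase_of_mem (self_mem_cellNeighbours c)]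
    have := card_cellNeighbours_le c
    omega
  have hhi0 : 0 ≤ hi := hlo.trans ((hb c).1.trans (hb c).2)
  have hq : ν.real (S : Set (Fin K × Fin K)) ≤ 8 * hi := by
    refine (measureReal_finset_bounds hb S).2.trans ?_
    refine mul_le_mul_of_nonneg_right ?_ hhi0
    exact_mod_cast hcard
  have hcS : c ∉ S := Finset.notMem_erase _ _
  have hadd : ν.real ((insert c S : Finset _) : Set (Fin K × Fin K)) =
      ν.real {c} + ν.real (S : Set (Fin K × Fin K)) := by
    rw [← sum_measureReal_singleton, ← sum_measureReal_singleton, Finset.sum_insert hcS]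
  have hp1 : ν.real ((insert c S : Finset _) : Set (Fin K × Fin K)) ≤ 1 := measureReal_le_one
  rw [hadd] at hp1 ⊢
  set q := ν.real (S : Set (Fin K × Fin K))
  set p := ν.real {c} with hp
  have hq0 : 0 ≤ q := measureReal_nonneg
  have hp0 : 0 ≤ p := measureReal_nonneg
  have h1 : (1 - (p + q)) ^ n ≤ (1 - q) ^ n * (1 - p) ^ n := by
    rw [← mul_pow]
    exact pow_le_pow_left₀ (by linarith) (by nlinarith) n
  have h2 : (1 - p) ^ n ≤ Real.exp (-(n * lo)) := by
    calc (1 - p) ^ n ≤ Real.exp (-lo) ^ n := by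
          refine pow_le_pow_left₀ (by linarith) ?_ n
          have := Real.add_one_le_exp (-lo)
          have := (hb c).1
          linarith
      _ = _ := by rw [← Real.exp_nat_mul]; ring_nf
  have h3 : (1 - 8 * hi) ^ n ≤ (1 - q) ^ n := pow_le_pow_left₀ (by linarith) (by linarith) n
  have h4 : Real.exp (-(n * lo)) ≤ 1 := by
    rw [Real.exp_le_one_iff]
    have : 0 ≤ n * lo := by positivity
    linarith
  have h5 : 0 ≤ (1 - q) ^ n := pow_nonneg (by linarith) n
  calc _ ≤ (1 - q) ^ n * (1 - Real.exp (-(n * lo))) :=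
        mul_le_mul_of_nonneg_right h3 (by linarith)
    _ ≤ (1 - q) ^ n * (1 - (1 - p) ^ n) := mul_le_mul_of_nonneg_left (by linarith) h5
    _ ≤ _ := by linarith

/-- The number of isolated cells is at least its lower mean bound, up to `s`, with high
probability. -/
theorem measureReal_isolatedCount_lt_le (hn : 0 < n) (hY : ∀ i, Measurable (Y i))
    (hind : iIndepFun Y P)
    (hν : ∀ i, P.map (Y i) = ν) {lo hi : ℝ} (hlo : 0 ≤ lo)
    (hb : ∀ c, lo ≤ ν.real {c} ∧ ν.real {c} ≤ hi) (hhi : 8 * hi ≤ 1) {s : ℝ} (hs : 0 ≤ s) :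
    P.real {ω | isolatedCount (fun i => Y i ω) ≤
        K ^ 2 * ((1 - 8 * hi) ^ n * (1 - Real.exp (-(n * lo)))) - s} ≤
      Real.exp (-s ^ 2 / (2 * n * 18 ^ 2)) := by
  classical
  have : IsProbabilityMeasure ν := by
    rw [← hν ⟨0, hn⟩]
    exact Measure.isProbabilityMeasure_map (hY _).aemeasurable
  have hm : Measurable fun ω => (fun i => Y i ω) := measurable_pi_lambda _ hY
  have hmean : K ^ 2 * ((1 - 8 * hi) ^ n * (1 - Real.exp (-(n * lo)))) ≤
      ∫ ω, isolatedCount (fun i => Y i ω) ∂P := by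
    have hset : ∀ c, MeasurableSet {ω | IsIsolated (fun i => Y i ω) c} := fun c =>
      hm (MeasurableSet.of_discrete (s := {y | IsIsolated y c}))
    have h1 : ∀ c, ∫ ω, (if IsIsolated (fun i => Y i ω) c then (1 : ℝ) else 0) ∂P =
        P.real {ω | IsIsolated (fun i => Y i ω) c} := fun c => by
      rw [← integral_indicator_one (hset c)]
      rfl
    unfold isolatedCount
    rw [integral_finsetSum _ fun c _ => ?_]
    · simp_rw [h1]
      calc _ = ∑ c : Fin K × Fin K, (1 - 8 * hi) ^ n * (1 - Real.exp (-(n * lo))) := by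
            rw [Finset.sum_const, Finset.card_univ, Fintype.card_prod, Fintype.card_fin,
              nsmul_eq_mul]
            push_cast
            ring
        _ ≤ _ := Finset.sum_le_sum fun c _ => measureReal_isIsolated_ge hY hind hν hlo hb hhi c
    · exact (integrable_const (1 : ℝ)).indicator (hset c)
  have h2 := measureReal_ge_le_of_bounded_differences hn hY hind hν (c := 18) (by norm_num)
    (F := fun y => -isolatedCount y) (fun y i b => by
      rw [neg_sub_neg, abs_sub_comm]
      exact abs_isolatedCount_update_sub_le y i b) hs
  refine le_trans (measureReal_mono ?_) h2
  intro ω hω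
  simp only [Set.mem_ofPred_eq] at hω ⊢
  rw [integral_neg]
  linarith

end IsolatedCells

/-! ### The lower tail. -/

section LowerBound

open Filter Topology

variable {h : unitSquare → unitSquare → ℝ} {α : ℝ}

theorem mst_nonneg (h0 : ∀ x y, 0 ≤ h x y) (x : ℕ → unitSquare) (n : ℕ) : 0 ≤ mst h α x n :=
  minSpanningTreeWeight_nonneg fun _ _ => Real.rpow_nonneg (h0 _ _) _

theorem measurable_mst {Ω : Type*} [MeasurableSpace Ω] {X : ℕ → Ω → unitSquare}
    (hX : ∀ i, Measurable (X i)) (hh : Measurable fun p : unitSquare × unitSquare => h p.1 p.2)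
    (n : ℕ) : Measurable fun ω => mst h α (fun i => X i ω) n := by
  unfold mst minSpanningTreeWeight graphWeight
  refine Measurable.iInf fun T => ?_
  refine Finset.measurable_fun_sum _ fun i _ => Finset.measurable_fun_sum _ fun j _ => ?_
  split_ifs
  · exact (hh.comp ((hX i).prodMk (hX j))).pow_const α
  · exact measurable_const

/-- An edge leaving an isolated cell ends outside its empty ring, so it spans at least one full cell
side `1 / K`. -/
theorem isolatedCount_sub_one_mul_le_mst {c₁ : ℝ} (hα : 0 ≤ α) (hc₁ : 0 ≤ c₁)
    (hsymm : ∀ x y, h x y = h y x) (hh : ∀ x y, c₁ * dist x y ≤ h x y) (x : ℕ → unitSquare)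
    {n : ℕ} (hn : 0 < n) (K : ℕ) [NeZero K] :
    (isolatedCount (fun i : Fin n => gridCell K K (x i)) - 1) * (c₁ / K) ^ α ≤ mst h α x n := by
  classical
  have h0 : ∀ x y, 0 ≤ h x y := fun x y => le_trans (by positivity) (hh x y)
  set y : Fin n → Fin K × Fin K := fun i => gridCell K K (x i) with hy
  have hcount : isolatedCount y = ((Finset.univ.filter fun c => IsIsolated y c).card : ℝ) := by
    unfold isolatedCount
    rw [Finset.card_filter]
    push_cast
    exact Finset.sum_congr rfl fun c _ => by congr
  rw [hcount]
  refine le_minSpanningTreeWeight (fun _ _ => Real.rpow_nonneg (h0 _ _) _)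
    (fun i j => by rw [hsymm]) hn y _ (fun c hc => ?_) (by positivity) (fun i j hi hij => ?_)
  · rw [Finset.mem_filter] at hc
    exact hc.2.1
  · rw [Finset.mem_filter] at hi
    have hnot : y j ∉ cellNeighbours (y i) := fun hj => hij (hi.2.2 j hj)
    have hd : 1 / (K : ℝ) ≤ dist (x i) (x j) := le_dist_of_gridCell fun hc => hnot (by
      simp only [cellNeighbours, Finset.mem_filter, Finset.mem_univ, true_and]
      exact hc)
    refine Real.rpow_le_rpow (by positivity) ?_ hα
    calc c₁ / K = c₁ * (1 / K) := by ring
      _ ≤ c₁ * dist (x i) (x j) := mul_le_mul_of_nonneg_left hd hc₁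
      _ ≤ _ := hh _ _

/-- The lower bound for the minimum spanning tree obtained from a given grid. -/
theorem measureReal_le_mst_ge {c₁ ε₁ ε₂ : ℝ} (hα : 0 ≤ α) (hc₁ : 0 ≤ c₁) (hε₁ : 0 < ε₁)
    {Ω : Type*} [MeasurableSpace Ω] {P : Measure Ω} [IsProbabilityMeasure P]
    {f : unitSquare → ℝ} {X : ℕ → Ω → unitSquare} (hf : ∀ x, ε₁ ≤ f x ∧ f x ≤ ε₂)
    (hX : ∀ i, Measurable (X i)) (hind : iIndepFun X P)
    (hlaw : ∀ i, P.map (X i) = squareVolume.withDensity fun x => ENNReal.ofReal (f x))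
    (hm : Measurable (fun p : unitSquare × unitSquare => h p.1 p.2))
    (hsymm : ∀ x y, h x y = h y x) (hh : ∀ x y, c₁ * dist x y ≤ h x y)
    {n K : ℕ} (hn : 0 < n) [NeZero K] (hK : 8 * (ε₂ / (K * K)) ≤ 1) {L s : ℝ} (hs : 0 ≤ s)
    (hL : L + 1 + s ≤ K ^ 2 * ((1 - 8 * (ε₂ / (K * K))) ^ n *
      (1 - Real.exp (-(n * (ε₁ / (K * K))))))) :
    1 - Real.exp (-s ^ 2 / (2 * n * 18 ^ 2)) ≤
      P.real {ω | L * (c₁ / K) ^ α ≤ mst h α (fun i => X i ω) n} := by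
  have hK0 : (0 : ℝ) < K := by exact_mod_cast NeZero.pos K
  have hmeas : MeasurableSet {ω | L * (c₁ / K) ^ α ≤ mst h α (fun i => X i ω) n} :=
    measurableSet_le measurable_const (measurable_mst hX hm n)
  set Y : Fin n → Ω → Fin K × Fin K := fun i ω => gridCell K K (X i ω) with hYdef
  have hY : ∀ i, Measurable (Y i) := fun i => measurable_gridCell.comp (hX i)
  have hYind : iIndepFun Y P :=
    (hind.precomp (g := fun i : Fin n => (i : ℕ)) Fin.val_injective).comp
      (fun _ => gridCell K K) fun _ => measurable_gridCell
  have hν : ∀ i, P.map (Y i) =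
      (squareVolume.withDensity fun x => ENNReal.ofReal (f x)).map (gridCell K K) := fun i => by
    rw [← hlaw i, Measure.map_map measurable_gridCell (hX i)]
    rfl
  have key := measureReal_isolatedCount_lt_le hn hY hYind hν
    (by positivity) (fun c => gridCell_law_bounds hε₁ hf c) hK hs
  have hsub : {ω | L * (c₁ / K) ^ α ≤ mst h α (fun i => X i ω) n}ᶜ ⊆
      {ω | isolatedCount (fun i => Y i ω) ≤ K ^ 2 * ((1 - 8 * (ε₂ / (K * K))) ^ n *
        (1 - Real.exp (-(n * (ε₁ / (K * K)))))) - s} := by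
    intro ω hω
    simp only [Set.mem_compl_iff, Set.mem_ofPred_eq, not_le] at hω ⊢
    have h1 := isolatedCount_sub_one_mul_le_mst hα hc₁ hsymm hh (fun i => X i ω) hn K
    by_contra hcon
    push Not at hcon
    have h2 : L ≤ isolatedCount (fun i => Y i ω) - 1 := by linarith
    have h3 := mul_le_mul_of_nonneg_right h2 (by positivity : 0 ≤ (c₁ / (K : ℝ)) ^ α)
    exact absurd (h3.trans h1) (not_le.2 hω)
  have := measureReal_mono hsub (μ := P)
  rw [probReal_compl_eq_one_sub hmeas] at this
  linarith

theorem tendsto_floor_mul_sqrt_div_sqrt {u : ℝ} (hu : 0 ≤ u) :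
    Tendsto (fun n : ℕ => (⌊u * √(n : ℝ)⌋₊ : ℝ) / √(n : ℝ)) atTop (𝓝 u) :=
  (tendsto_nat_floor_mul_div_atTop hu).comp
    (Real.tendsto_sqrt_atTop.comp tendsto_natCast_atTop_atTop)

theorem rpow_one_sub_half_eq {n : ℕ} (hn : 0 < n) (α : ℝ) :
    (n : ℝ) ^ (1 - α / 2) = n / √(n : ℝ) ^ α := by
  have hn' : (0 : ℝ) < n := by exact_mod_cast hn
  rw [Real.rpow_sub hn', Real.rpow_one, Real.sqrt_eq_rpow, ← Real.rpow_mul hn'.le]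
  ring_nf

theorem eventually_rpow_le_mul {p c : ℝ} (hp : p < 1) (hc : 0 < c) :
    ∀ᶠ n : ℕ in atTop, (n : ℝ) ^ p ≤ c * n := by
  have h1 : Tendsto (fun n : ℕ => (n : ℝ) ^ (-(1 - p))) atTop (𝓝 0) :=
    (tendsto_rpow_neg_atTop (by linarith)).comp tendsto_natCast_atTop_atTop
  filter_upwards [h1.eventually_le_const hc, eventually_gt_atTop 0] with n hn hn0
  have hn' : (0 : ℝ) < n := by exact_mod_cast hn0
  have h2 : (n : ℝ) ^ p = (n : ℝ) ^ (-(1 - p)) * n := by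
    rw [← Real.rpow_add_one hn'.ne']
    ring_nf
  rw [h2]
  exact mul_le_mul_of_nonneg_right hn hn'.le

theorem lowerConst_pos {α c₁ ε₁ ε₂ A : ℝ} (hc₁ : 0 < c₁) (hε₁ : 0 < ε₁) (hA : 0 < A) :
    0 < lowerConst α c₁ ε₁ ε₂ A := by
  unfold lowerConst
  have : Real.exp (-ε₁ * A ^ 2) < 1 := by
    rw [Real.exp_lt_one_iff]
    have : 0 < ε₁ * A ^ 2 := by positivity
    linarith
  have h2 : 0 < 1 - Real.exp (-ε₁ * A ^ 2) := by linarith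
  positivity

/-- With `K = ⌊A⁻¹ * √n⌋₊` the ratio `n / K ^ 2` tends to `A ^ 2`, so the powers turn into
exponentials. The sequence is the lower bound for the mean number of isolated cells, per node. -/
theorem tendsto_isolated_mean (ε₁ ε₂ : ℝ) {A : ℝ} (hA : 0 < A) :
    Tendsto (fun n : ℕ => (⌊A⁻¹ * √(n : ℝ)⌋₊ : ℝ) ^ 2 *
      ((1 - 8 * (ε₂ / ((⌊A⁻¹ * √(n : ℝ)⌋₊ : ℝ) * (⌊A⁻¹ * √(n : ℝ)⌋₊ : ℝ)))) ^ n *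
        (1 - Real.exp (-(n * (ε₁ / ((⌊A⁻¹ * √(n : ℝ)⌋₊ : ℝ) * (⌊A⁻¹ * √(n : ℝ)⌋₊ : ℝ))))))) / n)
      atTop (𝓝 (1 / A ^ 2 * (Real.exp (-8 * ε₂ * A ^ 2) * (1 - Real.exp (-ε₁ * A ^ 2))))) := by
  have h1 := tendsto_floor_mul_sqrt_div_sqrt (inv_pos.2 hA).le
  have hsq : ∀ n : ℕ, √(n : ℝ) ^ 2 = n := fun n => Real.sq_sqrt n.cast_nonneg
  have h2 : Tendsto (fun n : ℕ => (⌊A⁻¹ * √(n : ℝ)⌋₊ : ℝ) ^ 2 / n) atTop (𝓝 (1 / A ^ 2)) := by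
    have := h1.pow 2
    simp only [div_pow, hsq] at this
    simpa using this
  have h3 : Tendsto (fun n : ℕ => (n : ℝ) / ((⌊A⁻¹ * √(n : ℝ)⌋₊ : ℝ) * (⌊A⁻¹ * √(n : ℝ)⌋₊ : ℝ)))
      atTop (𝓝 (A ^ 2)) := by
    have := h2.inv₀ (by positivity)
    simpa [sq] using this
  have h4 : Tendsto (fun n : ℕ =>
      (1 - 8 * (ε₂ / ((⌊A⁻¹ * √(n : ℝ)⌋₊ : ℝ) * (⌊A⁻¹ * √(n : ℝ)⌋₊ : ℝ)))) ^ n) atTop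
      (𝓝 (Real.exp (-8 * ε₂ * A ^ 2))) := by
    have := Real.tendsto_one_add_pow_exp_of_tendsto
      (g := fun n : ℕ => -(8 * (ε₂ / ((⌊A⁻¹ * √(n : ℝ)⌋₊ : ℝ) * (⌊A⁻¹ * √(n : ℝ)⌋₊ : ℝ)))))
      (t := -8 * ε₂ * A ^ 2) ((h3.const_mul (-8 * ε₂)).congr fun n => by ring)
    simpa [sub_eq_add_neg] using this
  have h5 : Tendsto (fun n : ℕ =>
      Real.exp (-(n * (ε₁ / ((⌊A⁻¹ * √(n : ℝ)⌋₊ : ℝ) * (⌊A⁻¹ * √(n : ℝ)⌋₊ : ℝ)))))) atTop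
      (𝓝 (Real.exp (-ε₁ * A ^ 2))) :=
    (Real.continuous_exp.tendsto _).comp ((h3.const_mul (-ε₁)).congr fun n => by ring)
  refine (h2.mul (h4.mul (h5.const_sub 1))).congr fun n => ?_
  ring

/-- The lower tail of the minimum spanning tree. -/
theorem exists_forall_le_measureReal_lowerConst_le_mst (α c₁ ε₁ ε₂ : ℝ) (hα : 0 < α)
    (hc₁ : 0 < c₁) (hε₁ : 0 < ε₁) (A : ℝ) (hA : 0 < A) :
    ∃ n₀ : ℕ, ∀ (Ω : Type*) [MeasurableSpace Ω] (P : Measure Ω) [IsProbabilityMeasure P]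
      (f : unitSquare → ℝ) (X : ℕ → Ω → unitSquare) (h : unitSquare → unitSquare → ℝ),
      (∀ x, ε₁ ≤ f x ∧ f x ≤ ε₂) → (∀ i, Measurable (X i)) → iIndepFun X P →
      (∀ i, P.map (X i) = squareVolume.withDensity fun x => ENNReal.ofReal (f x)) →
      Measurable (fun p : unitSquare × unitSquare => h p.1 p.2) →
      (∀ x y, h x y = h y x) → (∀ x y, c₁ * dist x y ≤ h x y) →
      ∀ n : ℕ, n₀ ≤ n → 1 - Real.exp (-(n : ℝ) ^ (1 / 3 : ℝ)) ≤
        P.real {ω | lowerConst α c₁ ε₁ ε₂ A * (n : ℝ) ^ (1 - α / 2) ≤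
          mst h α (fun i => X i ω) n} := by
  -- The number of long edges per node that `lowerConst` requires. It is half of the limit in
  -- `tendsto_isolated_mean`, because of the `2` in the denominator of `lowerConst`.
  set κ : ℝ := lowerConst α c₁ ε₁ ε₂ A / (c₁ * A) ^ α with hκ
  have hκ0 : 0 < κ := div_pos (lowerConst_pos hc₁ hε₁ hA) (by positivity)
  have hκ2 : 1 / A ^ 2 * (Real.exp (-8 * ε₂ * A ^ 2) * (1 - Real.exp (-ε₁ * A ^ 2))) = 2 * κ := by
    rw [hκ, lowerConst]
    field_simp
  have hlim := tendsto_isolated_mean ε₁ ε₂ hA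
  rw [hκ2] at hlim
  have hK := tendsto_floor_mul_sqrt_div_sqrt (inv_pos.2 hA).le
  have hKtop : Tendsto (fun n : ℕ => ⌊A⁻¹ * √(n : ℝ)⌋₊) atTop atTop :=
    tendsto_nat_floor_atTop.comp ((Real.tendsto_sqrt_atTop.comp
      tendsto_natCast_atTop_atTop).const_mul_atTop (inv_pos.2 hA))
  have hKK : Tendsto (fun n : ℕ => 8 * (ε₂ / ((⌊A⁻¹ * √(n : ℝ)⌋₊ : ℝ) * (⌊A⁻¹ * √(n : ℝ)⌋₊ : ℝ))))
      atTop (𝓝 0) := by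
    have h1 : Tendsto (fun n : ℕ => (⌊A⁻¹ * √(n : ℝ)⌋₊ : ℝ)) atTop atTop :=
      tendsto_natCast_atTop_atTop.comp hKtop
    have := ((h1.atTop_mul_atTop₀ h1).const_div_atTop ε₂).const_mul 8
    simpa using this
  -- The constant `8 / 5` is `1 + 1 / 2 + 1 / 10`: the target `κ * n`, the deviation `κ * n / 2`,
  -- and `κ * n / 10 ≥ 1` for the edge lost at the root. The number `2592` is `4 * (2 * 18 ^ 2)`
  -- from the exponent of the deviation bound.
  obtain ⟨n₀, hn₀⟩ := eventually_atTop.1 ((hlim.eventually_const_le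
      (by linarith : 8 / 5 * κ < 2 * κ)).and ((hKK.eventually_le_const one_pos).and
      ((hKtop.eventually_gt_atTop 0).and ((eventually_gt_atTop 0).and
      ((eventually_rpow_le_mul (p := 1 / 3) (by norm_num)
        (by positivity : 0 < κ ^ 2 / 2592)).and
      (eventually_rpow_le_mul (p := 0) (by norm_num) (by positivity : 0 < κ / 10)))))))
  refine ⟨n₀, fun Ω _ P _ f X h hf hX hind hlaw hm hsymm hh n hn => ?_⟩
  obtain ⟨h1, h2, h3, h4, h5, h6⟩ := hn₀ n hn
  have hn' : (0 : ℝ) < n := by exact_mod_cast h4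
  have hs : 0 < √(n : ℝ) := Real.sqrt_pos.2 hn'
  set K := ⌊A⁻¹ * √(n : ℝ)⌋₊ with hKdef
  have : NeZero K := ⟨h3.ne'⟩
  have hK0 : (0 : ℝ) < K := by exact_mod_cast h3
  rw [le_div_iff₀ hn'] at h1
  rw [Real.rpow_zero] at h6
  have key := measureReal_le_mst_ge (s := κ * n / 2) (L := κ * n) hα.le hc₁.le hε₁ hf hX hind hlaw
    hm hsymm hh h4 h2 (by positivity) (by linarith)
  have hexp : Real.exp (-(κ * n / 2) ^ 2 / (2 * n * 18 ^ 2)) ≤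
      Real.exp (-(n : ℝ) ^ (1 / 3 : ℝ)) := by
    rw [Real.exp_le_exp, neg_div, neg_le_neg_iff]
    refine h5.trans (le_of_eq ?_)
    field_simp
    norm_num
  refine le_trans (by linarith) (key.trans (measureReal_mono fun ω hω => ?_))
  rw [Set.mem_ofPred_eq] at hω ⊢
  refine le_trans ?_ hω
  -- Rounding `K` down makes the cells larger, the favourable direction here.
  have h7 : c₁ * A / √(n : ℝ) ≤ c₁ / K := by
    rw [div_le_div_iff₀ hs hK0]
    have : (K : ℝ) ≤ A⁻¹ * √(n : ℝ) := Nat.floor_le (by positivity)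
    calc c₁ * A * K ≤ c₁ * A * (A⁻¹ * √(n : ℝ)) := mul_le_mul_of_nonneg_left this (by positivity)
      _ = c₁ * √(n : ℝ) := by field_simp
  have h8 := Real.rpow_le_rpow (by positivity) h7 hα.le
  calc lowerConst α c₁ ε₁ ε₂ A * (n : ℝ) ^ (1 - α / 2)
      = κ * n * (c₁ * A / √(n : ℝ)) ^ α := by
        rw [rpow_one_sub_half_eq h4, Real.div_rpow (by positivity) hs.le, hκ]
        have : 0 < (c₁ * A) ^ α := by positivity
        have : 0 < √(n : ℝ) ^ α := by positivity
        field_simp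
    _ ≤ κ * n * (c₁ / K) ^ α := mul_le_mul_of_nonneg_left h8 (by positivity)

end LowerBound

/-! ### Costs of runs of empty cells in a row. -/

section Gaps

variable {a b n : ℕ}

/-- The cells of the row `ρ` in the columns `κ, …, κ + r - 1`. -/
def rowWindow (ρ : Fin a) (κ r : ℕ) : Finset (Fin a × Fin b) :=
  Finset.univ.filter fun e => e.1 = ρ ∧ κ ≤ e.2 ∧ (e.2 : ℕ) < κ + r

theorem mem_rowWindow {ρ : Fin a} {κ r : ℕ} {e : Fin a × Fin b} :
    e ∈ rowWindow ρ κ r ↔ e.1 = ρ ∧ κ ≤ e.2 ∧ (e.2 : ℕ) < κ + r := by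
  simp [rowWindow]

theorem le_card_rowWindow (ρ : Fin a) {κ r : ℕ} (h : κ + r ≤ b) :
    r ≤ (rowWindow (b := b) ρ κ r).card := by
  calc r = (Finset.univ : Finset (Fin r)).card := by simp
    _ ≤ _ := by
      refine Finset.card_le_card_of_injOn (fun j => (ρ, ⟨κ + j, by have := j.2; omega⟩)) ?_ ?_
      · intro j _
        simp [mem_rowWindow]
      · intro j _ j' _ hj
        simp only [Prod.mk.injEq, Fin.mk.injEq, true_and] at hj
        exact Fin.ext (by omega)

/-- The `r` cells to the left of `c` exist and are empty. -/
def EmptyLeft (y : Fin n → Fin a × Fin b) (c : Fin a × Fin b) (r : ℕ) : Prop :=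
  r ≤ c.2 ∧ ∀ i, y i ∉ rowWindow c.1 (c.2 - r) r

/-- The difference between the costs of gaps of lengths `r + 2` and `r + 1`. -/
noncomputable def gapIncrement (α : ℝ) (r : ℕ) : ℝ := ((r : ℝ) + 2) ^ α - ((r : ℝ) + 1) ^ α

theorem gapIncrement_nonneg {α : ℝ} (hα : 0 ≤ α) (r : ℕ) : 0 ≤ gapIncrement α r :=
  sub_nonneg.2 (Real.rpow_le_rpow (by positivity) (by linarith) hα)

theorem sum_range_gapIncrement (α : ℝ) (k : ℕ) :
    ∑ r ∈ Finset.range k, gapIncrement α r = ((k : ℝ) + 1) ^ α - 1 := by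
  induction k with
  | zero => simp
  | succ k ih =>
    rw [Finset.sum_range_succ, ih, gapIncrement]
    push_cast
    ring_nf

open Classical in
/-- The excess cost of the gap to the left of an occupied cell, truncated at length `L + 1`. -/
noncomputable def gapCost (α : ℝ) (L : ℕ) (c : Fin a × Fin b) (y : Fin n → Fin a × Fin b) : ℝ :=
  ∑ r ∈ Finset.range L,
    if (∃ i, y i = c) ∧ EmptyLeft y c (r + 1) then gapIncrement α r else 0

theorem gapCost_nonneg {α : ℝ} (hα : 0 ≤ α) (L : ℕ) (c : Fin a × Fin b)
    (y : Fin n → Fin a × Fin b) : 0 ≤ gapCost α L c y :=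
  Finset.sum_nonneg fun r _ => by
    split_ifs
    exacts [gapIncrement_nonneg hα r, le_rfl]

theorem gapCost_le {α : ℝ} (hα : 0 ≤ α) (L : ℕ) (c : Fin a × Fin b)
    (y : Fin n → Fin a × Fin b) : gapCost α L c y ≤ ((L : ℝ) + 1) ^ α := by
  calc gapCost α L c y ≤ ∑ r ∈ Finset.range L, gapIncrement α r :=
        Finset.sum_le_sum fun r _ => by
          split_ifs
          exacts [le_rfl, gapIncrement_nonneg hα r]
    _ ≤ _ := by
        rw [sum_range_gapIncrement]
        linarith

/-- The cost at `c` looks only at `c` and the `L` cells to its left. Seen from a node, the cells it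
can influence are its own and the next `L` to the right. -/
theorem gapCost_update {α : ℝ} (L : ℕ) (c : Fin a × Fin b) (y : Fin n → Fin a × Fin b)
    (i : Fin n) (e : Fin a × Fin b) (h1 : c ∉ rowWindow (y i).1 (y i).2 (L + 1))
    (h2 : c ∉ rowWindow e.1 e.2 (L + 1)) :
    gapCost α L c (Function.update y i e) = gapCost α L c y := by
  classical
  refine Finset.sum_congr rfl fun r hr => ?_
  rw [Finset.mem_range] at hr
  have hw : ∀ d : Fin a × Fin b, c ∉ rowWindow d.1 d.2 (L + 1) → d ≠ c ∧
      (r + 1 ≤ (c.2 : ℕ) → d ∉ rowWindow c.1 (c.2 - (r + 1)) (r + 1)) := by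
    intro d hd
    refine ⟨?_, fun hle hd' => hd ?_⟩
    · rintro rfl
      exact hd (by simp [mem_rowWindow])
    · rw [mem_rowWindow] at hd' ⊢
      exact ⟨hd'.1.symm, by omega, by omega⟩
  have hyi := hw _ h1
  have he := hw _ h2
  have key : ∀ S : Fin a × Fin b → Prop, ¬ S (y i) → ¬ S e →
      ((∃ j, S (Function.update y i e j)) ↔ ∃ j, S (y j)) := by
    intro S hS1 hS2
    constructor
    · rintro ⟨j, hj⟩
      by_cases hji : j = i
      · subst hji
        simp only [Function.update_self] at hj
        exact (hS2 hj).elim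
      · exact ⟨j, by simpa [hji] using hj⟩
    · rintro ⟨j, hj⟩
      have hji : j ≠ i := by
        rintro rfl
        exact hS1 hj
      exact ⟨j, by simpa [hji] using hj⟩
  have k1 := key (fun d => d = c) hyi.1 he.1
  have k2 : EmptyLeft (Function.update y i e) c (r + 1) ↔ EmptyLeft y c (r + 1) := by
    unfold EmptyLeft
    refine and_congr_right fun hle => ?_
    have := key (fun d => d ∈ rowWindow c.1 (c.2 - (r + 1)) (r + 1)) (hyi.2 hle) (he.2 hle)
    rw [← not_exists, ← not_exists, not_iff_not]
    exact this
  simp only [k1, k2]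

theorem card_rowWindow_le (ρ : Fin a) (κ r : ℕ) : (rowWindow (b := b) ρ κ r).card ≤ r := by
  calc _ ≤ (Finset.Ico κ (κ + r)).card := by
        refine Finset.card_le_card_of_injOn (fun e => (e.2 : ℕ)) ?_ ?_
        · intro e he
          rw [Finset.mem_coe, mem_rowWindow] at he
          simpa using he.2
        · intro e he e' he' hee
          rw [Finset.mem_coe, mem_rowWindow] at he he'
          exact Prod.ext (he.1.trans he'.1.symm) (Fin.ext hee)
    _ = r := by simp

theorem abs_sum_gapCost_update_sub_le {α : ℝ} (hα : 0 ≤ α) (L : ℕ) (y : Fin n → Fin a × Fin b)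
    (i : Fin n) (e : Fin a × Fin b) :
    |∑ c, gapCost α L c (Function.update y i e) - ∑ c, gapCost α L c y| ≤
      2 * ((L : ℝ) + 1) * ((L : ℝ) + 1) ^ α := by
  have := abs_sum_update_sub_le (fun c y => gapCost α L c y)
    (by positivity : 0 ≤ ((L : ℝ) + 1) ^ α)
    (fun c y => ⟨gapCost_nonneg hα L c y, gapCost_le hα L c y⟩)
    (fun e => rowWindow e.1 e.2 (L + 1)) (D := L + 1) (fun e => card_rowWindow_le _ _ _)
    (fun c y i b h1 h2 => gapCost_update L c y i b h1 h2) y i e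
  simpa using this

/-- Subadditivity of `t ↦ t ^ α` for `α ≤ 1`. -/
theorem gapIncrement_le_one {α : ℝ} (hα : 0 ≤ α) (hα1 : α ≤ 1) (r : ℕ) :
    gapIncrement α r ≤ 1 := by
  have := Real.rpow_add_le_add_rpow (by positivity : 0 ≤ (r : ℝ) + 1) zero_le_one hα hα1
  rw [Real.one_rpow, add_assoc, one_add_one_eq_two] at this
  unfold gapIncrement
  linarith

/-- For `α ≤ 1` the total excess cost of the gaps is at most the number of cells. -/
theorem sum_gapCost_le {α : ℝ} (hα : 0 ≤ α) (hα1 : α ≤ 1) (L : ℕ) (y : Fin n → Fin a × Fin b) :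
    ∑ c, gapCost α L c y ≤ a * b := by
  classical
  set S : Finset ((Fin a × Fin b) × ℕ) := (Finset.univ ×ˢ Finset.range L).filter
    fun p => (∃ i, y i = p.1) ∧ EmptyLeft y p.1 (p.2 + 1) with hS
  have h1 : ∑ c, gapCost α L c y ≤ (S.card : ℝ) := by
    rw [hS, Finset.card_filter, Finset.sum_product]
    push_cast
    refine Finset.sum_le_sum fun c _ => Finset.sum_le_sum fun r _ => ?_
    split_ifs
    exacts [gapIncrement_le_one hα hα1 r, le_rfl]
  have h2 : S.card ≤ a * b := by
    calc S.card ≤ (Finset.univ : Finset (Fin a × Fin b)).card := by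
          -- The pair `(c, r)` is sent to the empty cell `r + 1` places to the left of `c`. The cell
          -- `c` is recovered as the first occupied cell to its right, so the map is injective.
          refine Finset.card_le_card_of_injOn (fun p => (p.1.1,
            ⟨p.1.2 - (p.2 + 1), by have := p.1.2.2; omega⟩)) (fun _ _ => Finset.mem_univ _) ?_
          rintro ⟨⟨ρ, κ⟩, r⟩ hp ⟨⟨ρ', κ'⟩, r'⟩ hp' he
          simp only [hS, Finset.coe_filter, Set.mem_ofPred_eq, EmptyLeft, mem_rowWindow] at hp hp'
          simp only [Prod.mk.injEq, Fin.mk.injEq] at he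
          obtain ⟨-, ⟨i, hi⟩, hr, hem⟩ := hp
          obtain ⟨-, ⟨i', hi'⟩, hr', hem'⟩ := hp'
          have e1 := hem i'
          have e2 := hem' i
          rw [hi'] at e1
          rw [hi] at e2
          obtain ⟨rfl, he⟩ := he
          simp only [true_and, not_and, not_lt] at e1 e2
          have hκ : (κ : ℕ) = κ' := by
            rcases lt_trichotomy (κ : ℕ) κ' with h | h | h
            · have := e2 (by omega); omega
            · exact h
            · have := e1 (by omega); omega
          have := Fin.ext hκ
          subst this
          simp only [Prod.mk.injEq, true_and]
          omega
      _ = a * b := by simp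
  exact h1.trans (by exact_mod_cast h2)

end Gaps

/-! ### The row-by-row spanning tree. -/

section RowTree

variable {h : unitSquare → unitSquare → ℝ} {α : ℝ}

/-- The cost of the tree which joins each node to an earlier node of its cell, to the preceding
occupied cell of its row, or to the preceding row. -/
theorem mst_le_of_rows {c₂ : ℝ} (hα : 0 ≤ α) (hc₂ : 0 ≤ c₂)
    (hsymm : ∀ x y, h x y = h y x) (h0 : ∀ x y, 0 ≤ h x y) (hh : ∀ x y, h x y ≤ c₂ * dist x y)
    (x : ℕ → unitSquare) {n : ℕ} (hn : 0 < n) {a b : ℕ} [NeZero a] [NeZero b] {D : ℝ}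
    (hD : 0 ≤ D) (hDa : 2 ≤ (D * a) ^ 2) (hDb : 8 ≤ (D * b) ^ 2) {L : ℕ} (hLb : L ≤ b)
    (hrun : ∀ (ρ : Fin a) (κ : ℕ), κ + L ≤ b →
      ∃ i : Fin n, gridCell a b (x i) ∈ rowWindow ρ κ L) :
    mst h α x n ≤ (c₂ * D) ^ α * (n + ∑ c, gapCost α L c (fun i : Fin n => gridCell a b (x i)) +
      a * ((L : ℝ) + 2) ^ α) := by
  classical
  have ha : (0 : ℝ) < a := by exact_mod_cast NeZero.pos a
  have hb : (0 : ℝ) < b := by exact_mod_cast NeZero.pos b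
  set y : Fin n → Fin a × Fin b := fun i => gridCell a b (x i) with hy
  set β := (c₂ * D) ^ α with hβ
  have hβ0 : 0 ≤ β := by positivity
  -- Two horizontally adjacent cells fit into a square of side `D / √2`, whose diagonal is `D`.
  have ha2 : (1 / (a : ℝ)) ^ 2 ≤ D ^ 2 / 2 := by
    rw [div_pow, one_pow, div_le_div_iff₀ (by positivity) (by positivity)]
    nlinarith
  have hb2 : (1 / (b : ℝ)) ^ 2 ≤ D ^ 2 / 8 := by
    rw [div_pow, one_pow, div_le_div_iff₀ (by positivity) (by positivity)]
    nlinarith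
  have hsplit : ∀ (u v : ℝ), (u / b) ^ 2 + (v / a) ^ 2 ≤ D ^ 2 * (u ^ 2 / 8 + v ^ 2 / 2) := by
    intro u v
    have e1 : (u / b) ^ 2 = u ^ 2 * (1 / (b : ℝ)) ^ 2 := by ring
    have e2 : (v / a) ^ 2 = v ^ 2 * (1 / (a : ℝ)) ^ 2 := by ring
    rw [e1, e2]
    nlinarith [mul_le_mul_of_nonneg_left hb2 (sq_nonneg u),
      mul_le_mul_of_nonneg_left ha2 (sq_nonneg v)]
  have hcost : ∀ (p q : unitSquare) (t : ℝ), 0 ≤ t → dist p q ^ 2 ≤ D ^ 2 * t ^ 2 →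
      h p q ^ α ≤ β * t ^ α := by
    intro p q t ht hpq
    rw [hβ, ← Real.mul_rpow (by positivity) ht]
    refine Real.rpow_le_rpow (h0 _ _) ((hh p q).trans ?_) hα
    rw [mul_assoc]
    refine mul_le_mul_of_nonneg_left ?_ hc₂
    exact le_of_sq_le_sq (by rwa [mul_pow]) (by positivity)
  -- Lexicographic order by row, column and index: each of the three kinds of edge goes to a node of
  -- smaller rank, and the root is the minimum.
  let rank : Fin n → ℕ ×ₗ ℕ ×ₗ ℕ := fun v => toLex ((y v).1, toLex (((y v).2 : ℕ), (v : ℕ)))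
  have hlt : ∀ u v, rank u < rank v ↔ ((y u).1 : ℕ) < (y v).1 ∨ ((y u).1 : ℕ) = (y v).1 ∧
      (((y u).2 : ℕ) < (y v).2 ∨ ((y u).2 : ℕ) = (y v).2 ∧ (u : ℕ) < v) := by
    intro u v
    simp only [rank, Prod.Lex.toLex_lt_toLex]
  have : Nonempty (Fin n) := ⟨⟨0, hn⟩⟩
  obtain ⟨r, hr⟩ := Finite.exists_min rank
  let first : Fin n → Prop := fun v => ∀ u, y u = y v → v ≤ u
  let leftmost : Fin n → Prop := fun v => ∀ u, (y u).1 = (y v).1 → (y v).2 ≤ (y u).2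
  let cost : Fin n → ℝ := fun v => β * (1 + ((if first v then gapCost α L (y v) y else 0) +
    if first v ∧ leftmost v then ((L : ℝ) + 2) ^ α else 0))
  have hL0 : 0 ≤ ((L : ℝ) + 2) ^ α := by positivity
  have hg0 : ∀ v, 0 ≤ (if first v then gapCost α L (y v) y else 0) := fun v => by
    split_ifs
    exacts [gapCost_nonneg hα _ _ _, le_rfl]
  have hl0 : ∀ v, 0 ≤ (if first v ∧ leftmost v then ((L : ℝ) + 2) ^ α else 0) := fun v => by
    split_ifs
    exacts [hL0, le_rfl]
  have hmain : mst h α x n ≤ ∑ v, cost v := by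
    refine minSpanningTreeWeight_le_sum (fun _ _ => Real.rpow_nonneg (h0 _ _) _)
      (fun i j => by rw [hsymm]) r rank cost ?_ ?_
    · have := hg0 r
      have := hl0 r
      positivity
    intro v hv
    have hrv : rank r < rank v := by
      refine lt_of_le_of_ne (hr v) fun e => hv ?_
      simp only [rank, toLex_inj, Prod.mk.injEq] at e
      exact (Fin.ext e.2.2).symm
    by_cases hfirst : first v
    swap
    · simp only [first, not_forall, not_le] at hfirst
      obtain ⟨u, hu, huv⟩ := hfirst
      refine ⟨u, (hlt u v).2 (Or.inr ⟨by rw [hu], Or.inr ⟨by rw [hu], huv⟩⟩), ?_⟩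
      have hd := dist_sq_le_of_gridCell (a := a) (b := b) (x := x v) (y := x u) (d := 0) (e := 0)
        (le_of_eq (congrArg (fun c : Fin a × Fin b => (c.1 : ℕ)) hu.symm))
        (le_of_eq (congrArg (fun c : Fin a × Fin b => (c.1 : ℕ)) hu))
        (le_of_eq (congrArg (fun c : Fin a × Fin b => (c.2 : ℕ)) hu.symm))
        (le_of_eq (congrArg (fun c : Fin a × Fin b => (c.2 : ℕ)) hu))
      refine (hcost _ _ 1 zero_le_one (hd.trans ((hsplit _ _).trans ?_))).trans ?_
      · push_cast
        nlinarith [sq_nonneg D]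
      · rw [Real.one_rpow]
        refine mul_le_mul_of_nonneg_left ?_ hβ0
        have := hg0 v
        have := hl0 v
        linarith
    by_cases hleft : leftmost v
    · -- the first node of a row is joined to the preceding row
      have hwin := hrun (y v).1 0 (by omega)
      obtain ⟨i, hi⟩ := hwin
      rw [mem_rowWindow] at hi
      have hvL : ((y v).2 : ℕ) < L := by
        have h1 : ((y v).2 : ℕ) ≤ (y i).2 := hleft i hi.1
        have h2 : ((y i).2 : ℕ) < 0 + L := hi.2.2
        omega
      have hrow : ((y r).1 : ℕ) < (y v).1 := by
        rcases (hlt r v).1 hrv with h1 | ⟨h1, h2 | ⟨h2, h3⟩⟩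
        · exact h1
        · have h3 : ((y v).2 : ℕ) ≤ (y r).2 := hleft r (Fin.ext h1)
          omega
        · have h4 : (v : ℕ) ≤ r := hfirst r (Prod.ext (Fin.ext h1) (Fin.ext h2))
          omega
      obtain ⟨u, hu⟩ := hrun ⟨(y v).1 - 1, by have := (y v).1.2; omega⟩ 0 (by omega)
      rw [mem_rowWindow] at hu
      have hu1 : ((y u).1 : ℕ) = (y v).1 - 1 := congrArg Fin.val hu.1
      have hu2 : ((y u).2 : ℕ) < 0 + L := hu.2.2
      refine ⟨u, (hlt u v).2 (Or.inl (by omega)), ?_⟩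
      have hd := dist_sq_le_of_gridCell (a := a) (b := b) (x := x v) (y := x u) (d := 1) (e := L)
        (by change ((y v).1 : ℕ) ≤ (y u).1 + 1; omega)
        (by change ((y u).1 : ℕ) ≤ (y v).1 + 1; omega)
        (by change ((y v).2 : ℕ) ≤ (y u).2 + L; omega)
        (by change ((y u).2 : ℕ) ≤ (y v).2 + L; omega)
      refine (hcost _ _ (L + 2) (by positivity) (hd.trans ((hsplit _ _).trans ?_))).trans ?_
      · push_cast
        refine mul_le_mul_of_nonneg_left ?_ (sq_nonneg D)
        have : (0 : ℝ) ≤ L := by positivity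
        nlinarith
      · refine mul_le_mul_of_nonneg_left ?_ hβ0
        have := hg0 v
        rw [if_pos (⟨hfirst, hleft⟩ : first v ∧ leftmost v)]
        linarith
    · -- the first node of a cell is joined to the preceding occupied cell of the row
      simp only [leftmost, not_forall, not_le] at hleft
      obtain ⟨u₀, hu₀, hlt₀⟩ := hleft
      obtain ⟨u, hu, hmax⟩ := Finset.exists_max_image
        (Finset.univ.filter fun u => (y u).1 = (y v).1 ∧ (y u).2 < (y v).2)
        (fun u => ((y u).2 : ℕ)) ⟨u₀, by simp [hu₀, hlt₀]⟩
      simp only [Finset.mem_filter, Finset.mem_univ, true_and] at hu hmax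
      -- The number of empty cells between the two occupied ones. If it were at least `L`, the `L`
      -- cells just left of `v` would be empty, against `hrun`.
      obtain ⟨m, hm⟩ : ∃ m : ℕ, ((y v).2 : ℕ) = (y u).2 + (m + 1) :=
        ⟨(y v).2 - (y u).2 - 1, by have : ((y u).2 : ℕ) < (y v).2 := hu.2; omega⟩
      have hu1 : ((y u).1 : ℕ) = (y v).1 := congrArg Fin.val hu.1
      have hmL : m < L := by
        by_contra hcon
        push Not at hcon
        have hvb := (y v).2.2
        obtain ⟨i, hi⟩ := hrun (y v).1 ((y v).2 - L) (by omega)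
        rw [mem_rowWindow] at hi
        have h1 : ((y v).2 : ℕ) - L ≤ (y i).2 := hi.2.1
        have h2 : ((y i).2 : ℕ) < (y v).2 - L + L := hi.2.2
        have h3 : ((y i).2 : ℕ) ≤ (y u).2 := hmax i ⟨hi.1, by
          change ((y i).2 : ℕ) < (y v).2
          omega⟩
        omega
      refine ⟨u, (hlt u v).2 (Or.inr ⟨hu1, Or.inl hu.2⟩), ?_⟩
      have hd := dist_sq_le_of_gridCell (a := a) (b := b) (x := x v) (y := x u) (d := 0)
        (e := m + 1)
        (by change ((y v).1 : ℕ) ≤ (y u).1 + 0; omega)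
        (by change ((y u).1 : ℕ) ≤ (y v).1 + 0; omega)
        (by change ((y v).2 : ℕ) ≤ (y u).2 + (m + 1); omega)
        (by change ((y u).2 : ℕ) ≤ (y v).2 + (m + 1); omega)
      -- The inequality is `(m + 2) ^ 2 / 8 + 1 / 2 ≤ (m + 1) ^ 2`, with equality for `m = 0`. This
      -- explains the constants `2` and `8` in `hDa` and `hDb`.
      refine (hcost _ _ (m + 1) (by positivity) (hd.trans ((hsplit _ _).trans ?_))).trans ?_
      · push_cast
        refine mul_le_mul_of_nonneg_left ?_ (sq_nonneg D)
        have : (0 : ℝ) ≤ m := by positivity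
        nlinarith
      · refine mul_le_mul_of_nonneg_left ?_ hβ0
        have hl := hl0 v
        rw [if_pos hfirst]
        -- The `m` cells to the left of `v` are empty, so the first `m` increments are all present
        -- and telescope.
        have hsum : ((m : ℝ) + 1) ^ α - 1 ≤ gapCost α L (y v) y := by
          rw [← sum_range_gapIncrement]
          unfold gapCost
          refine (Finset.sum_le_sum fun r' hr' => ?_).trans
            (Finset.sum_le_sum_of_subset_of_nonneg (Finset.range_subset_range.2 hmL.le)
              fun r' _ _ => ?_)
          · rw [Finset.mem_range] at hr'
            rw [if_pos]
            refine ⟨⟨v, rfl⟩, by omega, fun i hi => ?_⟩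
            rw [mem_rowWindow] at hi
            have := hmax i ⟨hi.1, by
              change ((y i).2 : ℕ) < (y v).2
              omega⟩
            omega
          · split_ifs
            exacts [gapIncrement_nonneg hα r', le_rfl]
        linarith
  refine hmain.trans ?_
  simp only [cost]
  rw [← Finset.mul_sum]
  refine mul_le_mul_of_nonneg_left ?_ hβ0
  rw [Finset.sum_add_distrib, Finset.sum_add_distrib, ← add_assoc]
  refine add_le_add (add_le_add (by simp) ?_) ?_
  · rw [← Finset.sum_filter]
    have hinj : Set.InjOn y (Finset.univ.filter first : Finset (Fin n)) := by
      intro u hu v hv huv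
      simp only [Finset.coe_filter, Finset.mem_univ, true_and, Set.mem_ofPred_eq] at hu hv
      exact le_antisymm (hu v huv.symm) (hv u huv)
    rw [← Finset.sum_image (f := fun c => gapCost α L c y) hinj]
    exact Finset.sum_le_sum_of_subset_of_nonneg (Finset.subset_univ _)
      fun c _ _ => gapCost_nonneg hα L c y
  · rw [← Finset.sum_filter, Finset.sum_const, nsmul_eq_mul]
    refine mul_le_mul_of_nonneg_right ?_ hL0
    have : (Finset.univ.filter fun v => first v ∧ leftmost v).card ≤
        (Finset.univ : Finset (Fin a)).card := by
      refine Finset.card_le_card_of_injOn (fun v => (y v).1) (fun _ _ => Finset.mem_univ _) ?_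
      intro u hu v hv huv
      simp only [Finset.coe_filter, Finset.mem_univ, true_and, Set.mem_ofPred_eq] at hu hv
      have h2 : (y u).2 = (y v).2 := le_antisymm (hu.2 v huv.symm) (hv.2 u huv)
      have h3 : y u = y v := Prod.ext huv h2
      exact le_antisymm (hu.1 v h3.symm) (hv.1 u h3)
    rw [Finset.card_univ, Fintype.card_fin] at this
    exact_mod_cast this

end RowTree

/-! ### Moments of the geometric distribution. -/

section GeometricMoment

theorem summable_geometric_mul_rpow {q : ℝ} (hq0 : 0 ≤ q) (hq1 : q < 1) (α : ℝ) :
    Summable fun j : ℕ => q ^ j * ((j : ℝ) + 1) ^ α := by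
  have h1 := (summable_nat_add_iff 1).2 (summable_pow_mul_geometric_of_norm_lt_one ⌈α⌉₊
    (r := q) (by rwa [Real.norm_eq_abs, abs_of_nonneg hq0]))
  rcases hq0.eq_or_lt with rfl | hq
  · refine summable_of_ne_finset_zero (s := {0}) fun j hj => ?_
    simp only [Finset.mem_singleton] at hj
    simp [hj]
  · refine Summable.of_nonneg_of_le (fun j => by positivity) (fun j => ?_) (h1.mul_left q⁻¹)
    rw [pow_succ]
    have h2 : ((j : ℝ) + 1) ^ α ≤ ((j : ℝ) + 1) ^ ⌈α⌉₊ := by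
      rw [← Real.rpow_natCast]
      exact Real.rpow_le_rpow_of_exponent_le (by linarith [j.cast_nonneg (α := ℝ)])
        (Nat.le_ceil α)
    push_cast
    calc q ^ j * ((j : ℝ) + 1) ^ α ≤ q ^ j * ((j : ℝ) + 1) ^ ⌈α⌉₊ := by gcongr
      _ = q⁻¹ * (((j : ℝ) + 1) ^ ⌈α⌉₊ * (q ^ j * q)) := by field_simp

/-- The moment of a geometric variable by summation by parts. -/
theorem one_add_sum_gapIncrement_le_geometricMoment {q : ℝ} (hq0 : 0 ≤ q) (hq1 : q < 1) {α : ℝ}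
    (hα : 0 ≤ α) (L : ℕ) :
    1 + ∑ r ∈ Finset.range L, gapIncrement α r * q ^ (r + 1) ≤ geometricMoment (1 - q) α := by
  have hs := summable_geometric_mul_rpow hq0 hq1 α
  have hs1 := (summable_nat_add_iff 1).2 hs
  have hs2 : Summable fun j : ℕ => q * (q ^ j * ((j : ℝ) + 1) ^ α) := hs.mul_left q
  have h1 : geometricMoment (1 - q) α =
      1 + ∑' j : ℕ, gapIncrement α j * q ^ (j + 1) := by
    calc geometricMoment (1 - q) α
        = ∑' j : ℕ, (q ^ j * ((j : ℝ) + 1) ^ α - q * (q ^ j * ((j : ℝ) + 1) ^ α)) := by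
          unfold geometricMoment
          refine tsum_congr fun j => ?_
          rw [sub_sub_cancel]
          ring
      _ = ∑' j : ℕ, q ^ j * ((j : ℝ) + 1) ^ α - ∑' j : ℕ, q * (q ^ j * ((j : ℝ) + 1) ^ α) :=
          hs.tsum_sub hs2
      _ = 1 + (∑' j : ℕ, q ^ (j + 1) * (((j + 1 : ℕ) : ℝ) + 1) ^ α -
            ∑' j : ℕ, q * (q ^ j * ((j : ℝ) + 1) ^ α)) := by
          rw [hs.tsum_eq_zero_add]
          simp
          ring
      _ = _ := by
          rw [← hs1.tsum_sub hs2]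
          congr 1
          refine tsum_congr fun j => ?_
          unfold gapIncrement
          push_cast
          ring_nf
  rw [h1]
  refine add_le_add le_rfl (Summable.sum_le_tsum _ (fun r _ => ?_) ?_)
  · exact mul_nonneg (gapIncrement_nonneg hα r) (by positivity)
  · refine (hs1.sub hs2).congr fun j => ?_
    unfold gapIncrement
    push_cast
    ring_nf

/-- The first increment `2 ^ α - 1` already has positive weight. For `α ≤ 1` this strict inequality
is all that the upper tail uses about the moment. -/
theorem one_lt_geometricMoment {q : ℝ} (hq0 : 0 < q) (hq1 : q < 1) {α : ℝ} (hα : 0 < α) :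
    1 < geometricMoment (1 - q) α := by
  have h1 := one_add_sum_gapIncrement_le_geometricMoment hq0.le hq1 hα.le 1
  have h2 : 0 < gapIncrement α 0 := by
    unfold gapIncrement
    have : (1 : ℝ) < 2 ^ α := Real.one_lt_rpow (by norm_num) hα
    simpa using this
  have h3 : 0 < ∑ r ∈ Finset.range 1, gapIncrement α r * q ^ (r + 1) := by
    rw [Finset.sum_range_one]
    positivity
  linarith

end GeometricMoment

/-! ### Probabilities of empty runs and the mean gap cost. -/

section GapProbabilities

variable {Ω : Type*} [MeasurableSpace Ω] {P : Measure Ω} {n a b : ℕ}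
  {Y : Fin n → Ω → Fin a × Fin b} {ν : Measure (Fin a × Fin b)}

theorem measureReal_rowWindow_empty_le (hY : ∀ i, Measurable (Y i)) (hind : iIndepFun Y P)
    (hν : ∀ i, P.map (Y i) = ν) [IsProbabilityMeasure ν] {lo : ℝ} (hlo : 0 ≤ lo)
    (hb : ∀ c, lo ≤ ν.real {c}) (ρ : Fin a) {κ r : ℕ} (hr : κ + r ≤ b) :
    P.real {ω | ∀ i, Y i ω ∉ rowWindow ρ κ r} ≤ Real.exp (-(n * (r * lo))) := by
  have h1 := measureReal_forall_notMem hY hind hν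
    ((rowWindow ρ κ r : Finset (Fin a × Fin b)) : Set (Fin a × Fin b))
  simp only [Finset.mem_coe] at h1
  rw [h1]
  have h2 := (measureReal_finset_bounds (ν := ν) (hi := 1)
    (fun c => ⟨hb c, measureReal_le_one⟩) (rowWindow ρ κ r)).1
  have h3 : ν.real ((rowWindow ρ κ r : Finset (Fin a × Fin b)) : Set (Fin a × Fin b)) ≤ 1 := measureReal_le_one
  have h4 : (r : ℝ) * lo ≤ (rowWindow (b := b) ρ κ r).card * lo :=
    mul_le_mul_of_nonneg_right (by exact_mod_cast le_card_rowWindow ρ hr) hlo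
  calc _ ≤ Real.exp (-(r * lo)) ^ n := by
        refine pow_le_pow_left₀ (by linarith) ?_ n
        have := Real.add_one_le_exp (-((r : ℝ) * lo))
        linarith
    _ = _ := by rw [← Real.exp_nat_mul]; ring_nf

variable [IsProbabilityMeasure P]

theorem measureReal_exists_rowWindow_empty_le (hY : ∀ i, Measurable (Y i)) (hind : iIndepFun Y P)
    (hν : ∀ i, P.map (Y i) = ν) [IsProbabilityMeasure ν] {lo : ℝ} (hlo : 0 ≤ lo)
    (hb : ∀ c, lo ≤ ν.real {c}) {L : ℕ} (hL : 0 < L) :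
    P.real {ω | ∃ (ρ : Fin a) (κ : ℕ), κ + L ≤ b ∧ ∀ i, Y i ω ∉ rowWindow ρ κ L} ≤
      a * b * Real.exp (-(n * (L * lo))) := by
  calc _ ≤ P.real (⋃ p ∈ (Finset.univ : Finset (Fin a × Fin b)),
          {ω | (p.2 : ℕ) + L ≤ b ∧ ∀ i, Y i ω ∉ rowWindow p.1 p.2 L}) := by
        refine measureReal_mono ?_ (measure_ne_top _ _)
        rintro ω ⟨ρ, κ, hκ, hω⟩
        simp only [Set.mem_iUnion, Finset.mem_univ, exists_true_left]
        exact ⟨(ρ, ⟨κ, by omega⟩), hκ, hω⟩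
    _ ≤ ∑ p : Fin a × Fin b,
          P.real {ω | (p.2 : ℕ) + L ≤ b ∧ ∀ i, Y i ω ∉ rowWindow p.1 p.2 L} :=
        measureReal_biUnion_finset_le _ _
    _ ≤ ∑ p : Fin a × Fin b, Real.exp (-(n * (L * lo))) := by
        refine Finset.sum_le_sum fun p _ => ?_
        by_cases hp : (p.2 : ℕ) + L ≤ b
        · simp only [hp, true_and]
          exact measureReal_rowWindow_empty_le hY hind hν hlo hb p.1 hp
        · simp [hp, Real.exp_nonneg]
    _ = _ := by simp

/-- The requirement that `c` be occupied is dropped. What remains is that `r + 1` given cells are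
empty, of probability at most `exp (-(n * lo)) ^ (r + 1)`. -/
theorem integral_sum_gapCost_le (hY : ∀ i, Measurable (Y i)) (hind : iIndepFun Y P)
    (hν : ∀ i, P.map (Y i) = ν) [IsProbabilityMeasure ν] {lo : ℝ} (hlo : 0 ≤ lo)
    (hb : ∀ c, lo ≤ ν.real {c}) {α : ℝ} (hα : 0 ≤ α) (L : ℕ) :
    ∫ ω, ∑ c, gapCost α L c (fun i => Y i ω) ∂P ≤
      a * b * ∑ r ∈ Finset.range L, gapIncrement α r * Real.exp (-(n * lo)) ^ (r + 1) := by
  classical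
  have hm : Measurable fun ω => (fun i => Y i ω) := measurable_pi_lambda _ hY
  have hset : ∀ c r, MeasurableSet
      {ω | (∃ i, Y i ω = c) ∧ EmptyLeft (fun i => Y i ω) c (r + 1)} := fun c r =>
    hm (MeasurableSet.of_discrete (s := {y | (∃ i, y i = c) ∧ EmptyLeft y c (r + 1)}))
  have hite : ∀ (c : Fin a × Fin b) (r : ℕ),
      (fun ω => if (∃ i, Y i ω = c) ∧ EmptyLeft (fun i => Y i ω) c (r + 1) then
        gapIncrement α r else 0) =
      {ω | (∃ i, Y i ω = c) ∧ EmptyLeft (fun i => Y i ω) c (r + 1)}.indicator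
        fun _ => gapIncrement α r := fun c r => by
    funext ω
    simp only [Set.indicator_apply, Set.mem_ofPred_eq]
  have hint : ∀ c r, Integrable
      (fun ω => if (∃ i, Y i ω = c) ∧ EmptyLeft (fun i => Y i ω) c (r + 1) then
        gapIncrement α r else 0) P := fun c r => by
    rw [hite]
    exact (integrable_const _).indicator (hset c r)
  unfold gapCost
  rw [integral_finsetSum _ fun c _ => integrable_finsetSum _ fun r _ => hint c r]
  calc _ ≤ ∑ c : Fin a × Fin b, ∑ r ∈ Finset.range L,
          gapIncrement α r * Real.exp (-(n * lo)) ^ (r + 1) := by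
        refine Finset.sum_le_sum fun c _ => ?_
        rw [integral_finsetSum _ fun r _ => hint c r]
        refine Finset.sum_le_sum fun r _ => ?_
        rw [hite, integral_indicator_const _ (hset c r), smul_eq_mul, mul_comm]
        refine mul_le_mul_of_nonneg_left ?_ (gapIncrement_nonneg hα r)
        by_cases hr : r + 1 ≤ (c.2 : ℕ)
        · refine (measureReal_mono ?_).trans ((measureReal_rowWindow_empty_le hY hind hν hlo hb
            c.1 (κ := c.2 - (r + 1)) (r := r + 1) (by have := c.2.2; omega)).trans
            (le_of_eq ?_))
          · exact fun ω hω => hω.2.2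
          · rw [← Real.exp_nat_mul]
            push_cast
            ring_nf
        · have : {ω | (∃ i, Y i ω = c) ∧ EmptyLeft (fun i => Y i ω) c (r + 1)} = ∅ := by
            ext ω
            simp [EmptyLeft, hr]
          rw [this, measureReal_empty]
          positivity
    _ = _ := by simp

theorem measureReal_sum_gapCost_gt_le (hn : 0 < n) (hY : ∀ i, Measurable (Y i))
    (hind : iIndepFun Y P) (hν : ∀ i, P.map (Y i) = ν) [IsProbabilityMeasure ν] {lo : ℝ}
    (hlo : 0 ≤ lo) (hb : ∀ c, lo ≤ ν.real {c}) {α : ℝ} (hα : 0 ≤ α) (L : ℕ) {s : ℝ}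
    (hs : 0 ≤ s) :
    P.real {ω | a * b * ∑ r ∈ Finset.range L, gapIncrement α r * Real.exp (-(n * lo)) ^ (r + 1) +
        s < ∑ c, gapCost α L c (fun i => Y i ω)} ≤
      Real.exp (-s ^ 2 / (2 * n * (2 * ((L : ℝ) + 1) * ((L : ℝ) + 1) ^ α) ^ 2)) := by
  have h1 := integral_sum_gapCost_le hY hind hν hlo hb hα L
  refine (measureReal_mono fun ω hω => ?_).trans
    (measureReal_ge_le_of_bounded_differences hn hY hind hν
      (F := fun y => ∑ c, gapCost α L c y) (by positivity)
      (abs_sum_gapCost_update_sub_le hα L) hs)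
  rw [Set.mem_ofPred_eq] at hω ⊢
  linarith

end GapProbabilities

/-! ### The upper tail for a given grid. -/

section UpperBoundGrid

variable {h : unitSquare → unitSquare → ℝ} {α : ℝ}

/-- The upper bound for the minimum spanning tree obtained from a given grid. -/
theorem measureReal_mst_le_ge {c₂ ε₁ ε₂ : ℝ} (hα : 0 < α) (hc₂ : 0 < c₂) (hε₁ : 0 < ε₁)
    {Ω : Type*} [MeasurableSpace Ω] {P : Measure Ω} [IsProbabilityMeasure P]
    {f : unitSquare → ℝ} {X : ℕ → Ω → unitSquare} (hf : ∀ x, ε₁ ≤ f x ∧ f x ≤ ε₂)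
    (hX : ∀ i, Measurable (X i)) (hind : iIndepFun X P)
    (hlaw : ∀ i, P.map (X i) = squareVolume.withDensity fun x => ENNReal.ofReal (f x))
    (hm : Measurable (fun p : unitSquare × unitSquare => h p.1 p.2))
    (hsymm : ∀ x y, h x y = h y x) (h0 : ∀ x y, 0 ≤ h x y) (hh : ∀ x y, h x y ≤ c₂ * dist x y)
    {n a b L : ℕ} (hn : 0 < n) [NeZero a] [NeZero b] {D A : ℝ} (hA : 0 < A)
    (hD : 0 ≤ D) (hDa : 2 ≤ (D * a) ^ 2) (hDb : 8 ≤ (D * b) ^ 2)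
    (hab : a * b ≤ n / A ^ 2) (hL : 0 < L) (hLb : L ≤ b) {G s : ℝ} (hs : 0 ≤ s)
    (hG : α ≤ 1 ∧ n / A ^ 2 ≤ G ∨
      n / A ^ 2 * (∑ r ∈ Finset.range L, gapIncrement α r * Real.exp (-ε₁ * A ^ 2) ^ (r + 1)) + s
        ≤ G) :
    1 - (n / A ^ 2 * Real.exp (-ε₁ * A ^ 2 * L) +
        Real.exp (-s ^ 2 / (2 * n * (2 * ((L : ℝ) + 1) * ((L : ℝ) + 1) ^ α) ^ 2))) ≤
      P.real {ω | mst h α (fun i => X i ω) n ≤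
        (c₂ * D) ^ α * (n + G + a * ((L : ℝ) + 2) ^ α)} := by
  have ha : (0 : ℝ) < a := by exact_mod_cast NeZero.pos a
  have hb : (0 : ℝ) < b := by exact_mod_cast NeZero.pos b
  have hn' : (0 : ℝ) < n := by exact_mod_cast hn
  have hmeas : MeasurableSet {ω | mst h α (fun i => X i ω) n ≤
      (c₂ * D) ^ α * (n + G + a * ((L : ℝ) + 2) ^ α)} :=
    measurableSet_le (measurable_mst hX hm n) measurable_const
  set Y : Fin n → Ω → Fin a × Fin b := fun i ω => gridCell a b (X i ω) with hYdef
  have hY : ∀ i, Measurable (Y i) := fun i => measurable_gridCell.comp (hX i)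
  have hYind : iIndepFun Y P :=
    (hind.precomp (g := fun i : Fin n => (i : ℕ)) Fin.val_injective).comp
      (fun _ => gridCell a b) fun _ => measurable_gridCell
  set ν : Measure (Fin a × Fin b) :=
    (squareVolume.withDensity fun x => ENNReal.ofReal (f x)).map (gridCell a b) with hνdef
  have hν : ∀ i, P.map (Y i) = ν := fun i => by
    rw [hνdef, ← hlaw i, Measure.map_map measurable_gridCell (hX i)]
    rfl
  have : IsProbabilityMeasure ν := by
    rw [← hν ⟨0, hn⟩]
    exact Measure.isProbabilityMeasure_map (hY _).aemeasurable
  have hlow : ∀ c, ε₁ / (a * b) ≤ ν.real {c} := fun c => (gridCell_law_bounds hε₁ hf c).1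
  have hlo : ε₁ * A ^ 2 ≤ n * (ε₁ / (a * b)) := by
    rw [← mul_div_assoc, le_div_iff₀ (by positivity)]
    calc ε₁ * A ^ 2 * (a * b) ≤ ε₁ * A ^ 2 * (n / A ^ 2) :=
          mul_le_mul_of_nonneg_left hab (by positivity)
      _ = n * ε₁ := by field_simp
  set runs : Set Ω :=
    {ω | ∃ (ρ : Fin a) (κ : ℕ), κ + L ≤ b ∧ ∀ i, Y i ω ∉ rowWindow ρ κ L} with hruns
  set gaps : Set Ω := {ω | G < ∑ c, gapCost α L c (fun i => Y i ω)} with hgaps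
  have hP1 : P.real runs ≤ n / A ^ 2 * Real.exp (-ε₁ * A ^ 2 * L) := by
    refine (measureReal_exists_rowWindow_empty_le hY hYind hν (by positivity) hlow hL).trans ?_
    refine mul_le_mul hab (Real.exp_le_exp.2 ?_) (Real.exp_nonneg _) (by positivity)
    have := mul_le_mul_of_nonneg_right hlo (L.cast_nonneg (α := ℝ))
    linarith
  have hP2 : P.real gaps ≤
      Real.exp (-s ^ 2 / (2 * n * (2 * ((L : ℝ) + 1) * ((L : ℝ) + 1) ^ α) ^ 2)) := by
    -- For `α ≤ 1` the counting bound `sum_gapCost_le` is deterministic and the event is empty.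
    -- Otherwise concentration is needed.
    rcases hG with ⟨hα1, hG⟩ | hG
    · have : gaps = ∅ := by
        refine Set.eq_empty_of_forall_notMem fun ω hω => ?_
        have h1 := sum_gapCost_le hα.le hα1 L (fun i => Y i ω)
        have h2 : G < ∑ c, gapCost α L c (fun i => Y i ω) := hω
        linarith
      rw [this, measureReal_empty]
      exact Real.exp_nonneg _
    · refine (measureReal_mono fun ω hω => ?_).trans
        (measureReal_sum_gapCost_gt_le hn hY hYind hν (by positivity) hlow hα.le L hs)
      refine lt_of_le_of_lt (le_trans (add_le_add ?_ le_rfl) hG) hω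
      refine mul_le_mul hab (Finset.sum_le_sum fun r _ => ?_)
        (Finset.sum_nonneg fun r _ =>
          mul_nonneg (gapIncrement_nonneg hα.le r) (by positivity)) (by positivity)
      refine mul_le_mul_of_nonneg_left (pow_le_pow_left₀ (Real.exp_nonneg _)
        (Real.exp_le_exp.2 (by linarith)) _) (gapIncrement_nonneg hα.le r)
  have hsub : {ω | mst h α (fun i => X i ω) n ≤
      (c₂ * D) ^ α * (n + G + a * ((L : ℝ) + 2) ^ α)}ᶜ ⊆ runs ∪ gaps := by
    intro ω hω
    by_contra hcon
    rw [Set.mem_union, not_or] at hcon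
    refine hω ?_
    have hrun : ∀ (ρ : Fin a) (κ : ℕ), κ + L ≤ b →
        ∃ i : Fin n, gridCell a b (X i ω) ∈ rowWindow ρ κ L := by
      intro ρ κ hκ
      by_contra hne
      exact hcon.1 ⟨ρ, κ, hκ, not_exists.1 hne⟩
    refine (mst_le_of_rows hα.le hc₂.le hsymm h0 hh (fun i => X i ω) hn hD hDa hDb hLb
      hrun).trans ?_
    refine mul_le_mul_of_nonneg_left ?_ (by positivity)
    have hgap : ∑ c, gapCost α L c (fun i => Y i ω) ≤ G := not_lt.1 hcon.2
    simp only [hYdef] at hgap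
    linarith
  have h1 := measureReal_mono hsub (μ := P)
  have h2 := measureReal_union_le (μ := P) runs gaps
  rw [probReal_compl_eq_one_sub hmeas] at h1
  linarith

end UpperBoundGrid

/-! ### Choice of the grid and the upper tail. -/

section UpperBound

open Filter Topology

theorem eventually_exp_neg_rpow_le {c p ε : ℝ} (hc : 0 < c) (hp : 0 < p) (r : ℝ) (hε : 0 < ε) :
    ∀ᶠ n : ℕ in atTop, Real.exp (-c * (n : ℝ) ^ p) ≤ ε * (n : ℝ) ^ r := by
  have h1 := ((isLittleO_exp_neg_mul_rpow_atTop hc (r / p)).bound hε)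
  have h2 : Tendsto (fun n : ℕ => (n : ℝ) ^ p) atTop atTop :=
    (tendsto_rpow_atTop hp).comp tendsto_natCast_atTop_atTop
  filter_upwards [h2.eventually h1] with n hn
  rw [Real.norm_eq_abs, Real.norm_eq_abs, abs_of_pos (Real.exp_pos _),
    abs_of_nonneg (by positivity), ← Real.rpow_mul n.cast_nonneg, mul_div_cancel₀ _ hp.ne'] at hn
  exact hn

theorem one_lt_geometricMoment_densityBound {α ε₁ ε₂ A : ℝ} (hα : 0 < α) (hε₁ : 0 < ε₁)
    (hε₂ : ε₁ ≤ ε₂) (hA : 0 < A) :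
    1 < geometricMoment (1 - Real.exp (-densityBound α ε₁ ε₂ * A ^ 2)) α := by
  have hδ : 0 < densityBound α ε₁ ε₂ := by
    unfold densityBound
    split_ifs <;> linarith
  refine one_lt_geometricMoment (Real.exp_pos _) ?_ hα
  rw [Real.exp_lt_one_iff, neg_mul, neg_lt_zero]
  positivity

theorem upperConst_pos {α c₂ ε₁ ε₂ A : ℝ} (hα : 0 < α) (hc₂ : 0 < c₂) (hε₁ : 0 < ε₁)
    (hε₂ : ε₁ ≤ ε₂) (hA : 0 < A) : 0 < upperConst α c₂ ε₁ ε₂ A := by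
  have := one_lt_geometricMoment_densityBound hα hε₁ hε₂ hA
  unfold upperConst
  positivity

theorem mul_sqrt_le_of_le_div {n : ℕ} (hn : 0 < n) {u x : ℝ} (h : u ≤ x / √(n : ℝ)) :
    u * √(n : ℝ) ≤ x :=
  (le_div_iff₀ (Real.sqrt_pos.2 (by exact_mod_cast hn))).1 h

set_option maxHeartbeats 1000000 in
/-- The upper tail of the minimum spanning tree. -/
theorem exists_forall_le_measureReal_mst_le_upperConst (α c₂ ε₁ ε₂ : ℝ) (hα : 0 < α)
    (hc₂ : 0 < c₂) (hε₁ : 0 < ε₁) (hε₂ : ε₁ ≤ ε₂) (A : ℝ) (hA : 0 < A) (q : ℝ) :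
    ∃ n₀ : ℕ, ∀ (Ω : Type*) [MeasurableSpace Ω] (P : Measure Ω) [IsProbabilityMeasure P]
      (f : unitSquare → ℝ) (X : ℕ → Ω → unitSquare) (h : unitSquare → unitSquare → ℝ),
      (∀ x, ε₁ ≤ f x ∧ f x ≤ ε₂) → (∀ i, Measurable (X i)) → iIndepFun X P →
      (∀ i, P.map (X i) = squareVolume.withDensity fun x => ENNReal.ofReal (f x)) →
      Measurable (fun p : unitSquare × unitSquare => h p.1 p.2) →
      (∀ x y, h x y = h y x) → (∀ x y, 0 ≤ h x y) → (∀ x y, h x y ≤ c₂ * dist x y) →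
      ∀ n : ℕ, n₀ ≤ n → 1 - (n : ℝ) ^ (-q) ≤
        P.real {ω | mst h α (fun i => X i ω) n ≤
          upperConst α c₂ ε₁ ε₂ A * (n : ℝ) ^ (1 - α / 2)} := by
  set g : ℝ := geometricMoment (1 - Real.exp (-densityBound α ε₁ ε₂ * A ^ 2)) α with hg
  have hg1 : 1 < g := one_lt_geometricMoment_densityBound hα hε₁ hε₂ hA
  set U : ℝ := 1 + g / A ^ 2 with hU
  -- The slack per node: `2 * τ` is at most `(g - 1) / A ^ 2`, available for `α ≤ 1`, and at most `1
  -- / (2 * A ^ 2)`, available for `α > 1` after a deviation `n / (2 * A ^ 2)`. One `τ` pays for the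
  -- links between rows, the other for rounding the grid.
  set τ : ℝ := min ((g - 1) / 2) (1 / 4) / A ^ 2 with hτ
  have hτ0 : 0 < τ := div_pos (lt_min (by linarith) (by norm_num)) (by positivity)
  have hτ1 : 2 * τ ≤ (g - 1) / A ^ 2 := by
    rw [hτ, ← mul_div_assoc]
    gcongr
    linarith [min_le_left ((g - 1) / 2) (1 / 4)]
  have hτ2 : 2 * τ ≤ 1 / 2 / A ^ 2 := by
    rw [hτ, ← mul_div_assoc]
    gcongr
    linarith [min_le_right ((g - 1) / 2) (1 / 4)]
  have hUτ : 0 < U - τ := by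
    have h1 : (g - 1) / A ^ 2 ≤ g / A ^ 2 := by gcongr; linarith
    linarith
  -- The unit length `2 * A / √n` is enlarged by `ρ` to make up for rounding `a` and `b` down, which
  -- raises the cost by `ρ ^ α`.
  set ρ : ℝ := (U / (U - τ)) ^ (1 / α) with hρ
  have hρ1 : 1 < ρ := Real.one_lt_rpow (by rw [one_lt_div hUτ]; linarith) (by positivity)
  have hρα : ρ ^ α * (U - τ) = U := by
    rw [hρ, ← Real.rpow_mul (div_nonneg (by linarith) hUτ.le), one_div, inv_mul_cancel₀ hα.ne',
      Real.rpow_one]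
    field_simp
  have hs2 : (0 : ℝ) < √2 := by positivity
  have hs22 : √(2 : ℝ) ^ 2 = 2 := Real.sq_sqrt (by norm_num)
  -- There are about `u * √n` rows and `v * √n` columns. Here `u * v = 1 / A ^ 2` fixes the cell
  -- area, and `v = 2 * u` makes two adjacent cells nearly a square of diagonal `2 * A / √n`.
  set u : ℝ := (√2 * A)⁻¹ with hu
  set v : ℝ := √2 / A with hv
  have hu0 : 0 < u := by positivity
  have hv0 : 0 < v := by positivity
  have huA : 2 * A * u = √2 := by
    rw [hu]
    field_simp
    linarith
  have hvA : 2 * A * v = 2 * √2 := by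
    rw [hv]
    field_simp
  have huv : u * v = 1 / A ^ 2 := by
    rw [hu, hv]
    field_simp
  -- Gaps are cut off at length about `n ^ η`, so `(L + 1) ^ (α + 1)` is of order at most `n ^ (1 /
  -- 8)`. Then the row links cost `O(n ^ (5 / 8))` units, and the deviation exponent is at least `n
  -- ^ (3 / 4) / C`.
  set η : ℝ := 1 / (8 * (α + 1)) with hη
  have hη0 : 0 < η := by positivity
  have hηα : η * (α + 1) = 1 / 8 := by
    rw [hη]
    field_simp
  have hη8 : η ≤ 1 / 8 := by nlinarith
  set C : ℝ := 32 * A ^ 4 * ((4 : ℝ) ^ (α + 1)) ^ 2 with hC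
  have hC0 : 0 < C := by positivity
  obtain ⟨n₀, hn₀⟩ := eventually_atTop.1
    (((tendsto_floor_mul_sqrt_div_sqrt hu0.le).eventually_const_le
      (div_lt_self hu0 hρ1)).and
    (((tendsto_floor_mul_sqrt_div_sqrt hv0.le).eventually_const_le
      (div_lt_self hv0 hρ1)).and
    ((eventually_gt_atTop 0).and
    ((eventually_rpow_le_mul (p := 5 / 8) (by norm_num)
      (by positivity : 0 < v / ρ / 4)).and
    ((eventually_rpow_le_mul (p := 5 / 8) (by norm_num)
      (by positivity : 0 < τ / (u * 4 ^ α))).and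
    ((eventually_exp_neg_rpow_le (by positivity : 0 < ε₁ * A ^ 2) hη0 (-q - 1)
      (by positivity : 0 < A ^ 2 / 2)).and
    (eventually_exp_neg_rpow_le (by positivity : 0 < 1 / C) (p := 3 / 4) (by norm_num) (-q)
      (by norm_num : (0 : ℝ) < 1 / 2))))))))
  refine ⟨n₀, fun Ω _ P _ f X h hf hX hind hlaw hm hsymm h0 hh n hn => ?_⟩
  obtain ⟨hau, hbv, hnpos, h4, h5, h6, h7⟩ := hn₀ n hn
  have hn' : (0 : ℝ) < n := by exact_mod_cast hnpos
  have hn1 : (1 : ℝ) ≤ n := by exact_mod_cast hnpos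
  have hs : 0 < √(n : ℝ) := Real.sqrt_pos.2 hn'
  have hss : √(n : ℝ) * √(n : ℝ) = n := Real.mul_self_sqrt hn'.le
  set a := ⌊u * √(n : ℝ)⌋₊ with ha
  set b := ⌊v * √(n : ℝ)⌋₊ with hb
  replace hau := mul_sqrt_le_of_le_div hnpos hau
  replace hbv := mul_sqrt_le_of_le_div hnpos hbv
  have ha0 : (0 : ℝ) < a := lt_of_lt_of_le (by positivity) hau
  have hb0 : (0 : ℝ) < b := lt_of_lt_of_le (by positivity) hbv
  have : NeZero a := ⟨by exact_mod_cast ha0.ne'⟩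
  have : NeZero b := ⟨by exact_mod_cast hb0.ne'⟩
  have hau' : (a : ℝ) ≤ u * √(n : ℝ) := Nat.floor_le (by positivity)
  have hbv' : (b : ℝ) ≤ v * √(n : ℝ) := Nat.floor_le (by positivity)
  set L := ⌈(n : ℝ) ^ η⌉₊ with hL
  have hnη : 1 ≤ (n : ℝ) ^ η := Real.one_le_rpow hn1 hη0.le
  have hLη : (n : ℝ) ^ η ≤ L := Nat.le_ceil _
  have hL4 : (L : ℝ) + 2 ≤ 4 * (n : ℝ) ^ η := by
    have := Nat.ceil_lt_add_one (by positivity : 0 ≤ (n : ℝ) ^ η)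
    linarith
  have hn58 : (n : ℝ) ^ (1 / 8 : ℝ) * √(n : ℝ) = (n : ℝ) ^ (5 / 8 : ℝ) := by
    rw [Real.sqrt_eq_rpow, ← Real.rpow_add hn']
    norm_num
  have hLb : L ≤ b := by
    have h8 : (n : ℝ) ^ η ≤ (n : ℝ) ^ (1 / 8 : ℝ) := Real.rpow_le_rpow_of_exponent_le hn1 hη8
    have h9 : 4 * (n : ℝ) ^ (1 / 8 : ℝ) ≤ v / ρ * √(n : ℝ) := by
      refine le_of_mul_le_mul_right ?_ hs
      rw [mul_assoc, hn58, mul_assoc, hss]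
      linarith
    have : (L : ℝ) ≤ b := by linarith
    exact_mod_cast this
  set D : ℝ := ρ * (2 * A) / √(n : ℝ) with hD
  have hDa : 2 ≤ (D * a) ^ 2 := by
    have : √2 ≤ D * a := by
      calc √2 = D * (u / ρ * √(n : ℝ)) := by
            rw [← huA, hD]
            field_simp
        _ ≤ D * a := mul_le_mul_of_nonneg_left hau (by positivity)
    exact hs22 ▸ pow_le_pow_left₀ hs2.le this 2
  have hDb : 8 ≤ (D * b) ^ 2 := by
    have : 2 * √2 ≤ D * b := by
      calc 2 * √2 = D * (v / ρ * √(n : ℝ)) := by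
            rw [← hvA, hD]
            field_simp
        _ ≤ D * b := mul_le_mul_of_nonneg_left hbv (by positivity)
    calc (8 : ℝ) = (2 * √2) ^ 2 := by
          rw [mul_pow, hs22]
          norm_num
      _ ≤ _ := pow_le_pow_left₀ (by positivity) this 2
  have hab : (a : ℝ) * b ≤ n / A ^ 2 := by
    calc (a : ℝ) * b ≤ u * √(n : ℝ) * (v * √(n : ℝ)) := by gcongr
      _ = u * v * (√(n : ℝ) * √(n : ℝ)) := by ring
      _ = n / A ^ 2 := by rw [huv, hss]; ring
  have hLpos : 0 < L := by
    have : (0 : ℝ) < L := by linarith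
    exact_mod_cast this
  have hG : α ≤ 1 ∧ n / A ^ 2 ≤ n * (g / A ^ 2 - 2 * τ) ∨
      n / A ^ 2 * (∑ r ∈ Finset.range L, gapIncrement α r * Real.exp (-ε₁ * A ^ 2) ^ (r + 1)) +
        n / (2 * A ^ 2) ≤ n * (g / A ^ 2 - 2 * τ) := by
    by_cases hα1 : α ≤ 1
    · refine Or.inl ⟨hα1, ?_⟩
      have : (g - 1) / A ^ 2 = g / A ^ 2 - 1 / A ^ 2 := by ring
      calc (n : ℝ) / A ^ 2 = n * (1 / A ^ 2) := by ring
        _ ≤ _ := mul_le_mul_of_nonneg_left (by linarith) hn'.le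
    · refine Or.inr ?_
      have hq1 : Real.exp (-ε₁ * A ^ 2) < 1 := by
        rw [Real.exp_lt_one_iff, neg_mul, neg_lt_zero]
        positivity
      have h1 := one_add_sum_gapIncrement_le_geometricMoment (Real.exp_nonneg _) hq1 hα.le L
      have h2 : geometricMoment (1 - Real.exp (-ε₁ * A ^ 2)) α = g := by
        rw [hg, densityBound, if_neg hα1]
      rw [h2] at h1
      calc _ ≤ n / A ^ 2 * (g - 1) + n / (2 * A ^ 2) := by
            gcongr
            linarith
        _ = n * (g / A ^ 2 - 1 / 2 / A ^ 2) := by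
            field_simp
            ring
        _ ≤ _ := mul_le_mul_of_nonneg_left (by linarith) hn'.le
  have key := measureReal_mst_le_ge hα hc₂ hε₁ hf hX hind hlaw hm hsymm h0 hh hnpos hA
    (by positivity : 0 ≤ D) hDa hDb hab hLpos hLb
    (by positivity : 0 ≤ n / (2 * A ^ 2)) hG
  have hp1 : n / A ^ 2 * Real.exp (-ε₁ * A ^ 2 * L) ≤ (n : ℝ) ^ (-q) / 2 := by
    calc n / A ^ 2 * Real.exp (-ε₁ * A ^ 2 * L)
        ≤ n / A ^ 2 * (A ^ 2 / 2 * (n : ℝ) ^ (-q - 1)) := by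
          refine mul_le_mul_of_nonneg_left (le_trans (Real.exp_le_exp.2 ?_) h6) (by positivity)
          have := mul_le_mul_of_nonneg_left hLη (by positivity : 0 ≤ ε₁ * A ^ 2)
          linarith
      _ = (n : ℝ) ^ (-q) / 2 := by
          rw [Real.rpow_sub_one hn'.ne']
          field_simp
  have hp2 : Real.exp (-(n / (2 * A ^ 2)) ^ 2 /
      (2 * n * (2 * ((L : ℝ) + 1) * ((L : ℝ) + 1) ^ α) ^ 2)) ≤ (n : ℝ) ^ (-q) / 2 := by
    refine le_trans (Real.exp_le_exp.2 ?_) (h7.trans (le_of_eq (by ring)))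
    have hL1 : (0 : ℝ) < (L : ℝ) + 1 := by positivity
    have e1 : ((L : ℝ) + 1) * ((L : ℝ) + 1) ^ α = ((L : ℝ) + 1) ^ (α + 1) := by
      rw [Real.rpow_add_one hL1.ne', mul_comm]
    have e2 : ((L : ℝ) + 1) ^ (α + 1) ≤ 4 ^ (α + 1) * (n : ℝ) ^ (1 / 8 : ℝ) := by
      calc ((L : ℝ) + 1) ^ (α + 1) ≤ (4 * (n : ℝ) ^ η) ^ (α + 1) :=
            Real.rpow_le_rpow hL1.le (by linarith) (by linarith)
        _ = _ := by
            rw [Real.mul_rpow (by norm_num) (by positivity), ← Real.rpow_mul hn'.le, hηα]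
    have e3 : ((n : ℝ) ^ (1 / 8 : ℝ)) ^ 2 * (n : ℝ) ^ (3 / 4 : ℝ) = n := by
      rw [← Real.rpow_natCast, ← Real.rpow_mul hn'.le, ← Real.rpow_add hn']
      norm_num
    rw [neg_div, neg_mul, neg_le_neg_iff, mul_assoc 2 ((L : ℝ) + 1), e1,
      le_div_iff₀ (by positivity)]
    calc 1 / C * (n : ℝ) ^ (3 / 4 : ℝ) * (2 * n * (2 * ((L : ℝ) + 1) ^ (α + 1)) ^ 2)
        ≤ 1 / C * (n : ℝ) ^ (3 / 4 : ℝ) *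
            (2 * n * (2 * (4 ^ (α + 1) * (n : ℝ) ^ (1 / 8 : ℝ))) ^ 2) := by gcongr
      _ = 8 / C * ((4 : ℝ) ^ (α + 1)) ^ 2 * n *
            (((n : ℝ) ^ (1 / 8 : ℝ)) ^ 2 * (n : ℝ) ^ (3 / 4 : ℝ)) := by ring
      _ = (n / (2 * A ^ 2)) ^ 2 := by
          rw [e3, hC]
          field_simp
          norm_num
  refine le_trans (by linarith) (key.trans (measureReal_mono fun ω hω => ?_))
  rw [Set.mem_ofPred_eq] at hω ⊢
  refine hω.trans ?_
  have hrow : a * ((L : ℝ) + 2) ^ α ≤ τ * n := by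
    have e1 : ((L : ℝ) + 2) ^ α ≤ 4 ^ α * (n : ℝ) ^ (1 / 8 : ℝ) := by
      calc ((L : ℝ) + 2) ^ α ≤ (4 * (n : ℝ) ^ η) ^ α :=
            Real.rpow_le_rpow (by positivity) hL4 hα.le
        _ = 4 ^ α * (n : ℝ) ^ (η * α) := by
            rw [Real.mul_rpow (by norm_num) (by positivity), ← Real.rpow_mul hn'.le]
        _ ≤ _ := by
            gcongr
            linarith
    calc a * ((L : ℝ) + 2) ^ α ≤ u * √(n : ℝ) * (4 ^ α * (n : ℝ) ^ (1 / 8 : ℝ)) := by gcongr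
      _ = u * 4 ^ α * ((n : ℝ) ^ (1 / 8 : ℝ) * √(n : ℝ)) := by ring
      _ ≤ u * 4 ^ α * (τ / (u * 4 ^ α) * n) := by
          rw [hn58]
          gcongr
      _ = τ * n := by field_simp
  calc (c₂ * D) ^ α * (n + n * (g / A ^ 2 - 2 * τ) + a * ((L : ℝ) + 2) ^ α)
      ≤ (c₂ * D) ^ α * (n * (U - τ)) := by
        refine mul_le_mul_of_nonneg_left ?_ (by positivity)
        rw [hU]
        linarith
    _ = (2 * c₂ * A) ^ α * (ρ ^ α * (U - τ)) * (n / √(n : ℝ) ^ α) := by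
        have : c₂ * D = 2 * c₂ * A * ρ / √(n : ℝ) := by
          rw [hD]
          ring
        rw [this, Real.div_rpow (by positivity) hs.le, Real.mul_rpow (by positivity) (by linarith)]
        ring
    _ = upperConst α c₂ ε₁ ε₂ A * (n : ℝ) ^ (1 - α / 2) := by
        rw [hρα, rpow_one_sub_half_eq hnpos]
        rfl

/-- The star centred at node `0`, with `2` as a crude bound for all distances. It controls the
moments on the exceptional event. -/
theorem mst_le_mul {h : unitSquare → unitSquare → ℝ} {α c₂ : ℝ} (hα : 0 ≤ α) (hc₂ : 0 ≤ c₂)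
    (hsymm : ∀ x y, h x y = h y x) (h0 : ∀ x y, 0 ≤ h x y) (hh : ∀ x y, h x y ≤ c₂ * dist x y)
    (x : ℕ → unitSquare) {n : ℕ} (hn : 0 < n) : mst h α x n ≤ n * (2 * c₂) ^ α := by
  have key := minSpanningTreeWeight_le_sum (w := fun i j : Fin n => h (x i) (x j) ^ α)
    (fun _ _ => Real.rpow_nonneg (h0 _ _) _) (fun i j => by rw [hsymm]) ⟨0, hn⟩
    (fun i => (i : ℕ)) (fun _ => (2 * c₂) ^ α) (by positivity) (fun v hv => ⟨⟨0, hn⟩, ?_, ?_⟩)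
  · exact key.trans (le_of_eq (by simp))
  · exact Nat.pos_of_ne_zero fun e => hv (Fin.ext e)
  · refine Real.rpow_le_rpow (h0 _ _) ((hh _ _).trans ?_) hα
    nlinarith [dist_unitSquare_le_two (x v) (x (⟨0, hn⟩ : Fin n))]

end UpperBound

/-! ### The theorem: tails and moments. -/

theorem theorem1 (α c₁ c₂ ε₁ ε₂ : ℝ) (hα : 0 < α) (hc₁ : 0 < c₁) (hc₂ : 0 < c₂)
    (hε₁ : 0 < ε₁) (hε₂ : ε₁ ≤ ε₂) (A : ℝ) (hA : 0 < A) (k : ℕ) (hk : 1 ≤ k) :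
    ∃ n₀ : ℕ, ∀ (Ω : Type*) [MeasurableSpace Ω] (P : Measure Ω) [IsProbabilityMeasure P]
      (f : unitSquare → ℝ) (X : ℕ → Ω → unitSquare) (h : unitSquare → unitSquare → ℝ),
      -- `f` is a measurable density on the unit square with values between `ε₁` and `ε₂`
      Measurable f → (∀ x, ε₁ ≤ f x ∧ f x ≤ ε₂) →
      -- the nodes are independent and identically distributed with density `f`
      (∀ i, Measurable (X i)) → iIndepFun X P →
      (∀ i, P.map (X i) = squareVolume.withDensity fun x => ENNReal.ofReal (f x)) →
      -- `h` is measurable, symmetric and comparable with the Euclidean distance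
      Measurable (fun p : unitSquare × unitSquare => h p.1 p.2) →
      (∀ x y, h x y = h y x) → (∀ x y, c₁ * dist x y ≤ h x y ∧ h x y ≤ c₂ * dist x y) →
      ∀ n : ℕ, n₀ ≤ n →
        1 - Real.exp (-(n : ℝ) ^ (1 / 3 : ℝ)) ≤
            P.real {ω | lowerConst α c₁ ε₁ ε₂ A * (n : ℝ) ^ (1 - α / 2) *
              (1 - 4 * √A / (n : ℝ) ^ (1 / 4 : ℝ)) ≤ mst h α (fun i => X i ω) n} ∧
        1 - 1 / (n : ℝ) ^ (2 * k) ≤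
            P.real {ω | mst h α (fun i => X i ω) n ≤
              upperConst α c₂ ε₁ ε₂ A * (n : ℝ) ^ (1 - α / 2) *
                (1 + 2 / (n : ℝ) ^ (1 / 16 : ℝ))} ∧
        Integrable (fun ω => (mst h α (fun i => X i ω) n / (n : ℝ) ^ (1 - α / 2)) ^ k) P ∧
        lowerConst α c₁ ε₁ ε₂ A ^ k * (1 - 36 * k * √A / (n : ℝ) ^ (1 / 4 : ℝ)) ≤
            ∫ ω, (mst h α (fun i => X i ω) n / (n : ℝ) ^ (1 - α / 2)) ^ k ∂P ∧
        ∫ ω, (mst h α (fun i => X i ω) n / (n : ℝ) ^ (1 - α / 2)) ^ k ∂P ≤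
            upperConst α c₂ ε₁ ε₂ A ^ k * (1 + 2 * k / (n : ℝ) ^ (1 / 16 : ℝ)) := by
  set C₁ := lowerConst α c₁ ε₁ ε₂ A with hC₁
  set C₂ := upperConst α c₂ ε₁ ε₂ A with hC₂
  have hC₁0 : 0 < C₁ := lowerConst_pos hc₁ hε₁ hA
  have hC₂0 : 0 < C₂ := upperConst_pos hα hc₂ hε₁ hε₂ hA
  have hk0 : (0 : ℝ) < k := by exact_mod_cast hk
  obtain ⟨n₁, hn₁⟩ := exists_forall_le_measureReal_lowerConst_le_mst α c₁ ε₁ ε₂ hα hc₁ hε₁ A hA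
  -- The star bounds the normalised `k`-th power by a constant times `n ^ (α * k / 2)`. The exponent
  -- chosen here cancels this growth and leaves `n ^ (-2 * k)`.
  obtain ⟨n₂, hn₂⟩ := exists_forall_le_measureReal_mst_le_upperConst α c₂ ε₁ ε₂ hα hc₂ hε₁ hε₂ A hA
    (α * k / 2 + 2 * k)
  have hB0 : 0 < ((2 * c₂) ^ α) ^ k := by positivity
  obtain ⟨n₃, hn₃⟩ := Filter.eventually_atTop.1
    ((eventually_exp_neg_rpow_le one_pos (by norm_num : (0 : ℝ) < 1 / 3) (-(1 / 4))
      (by positivity : 0 < 36 * k * √A)).and ((Filter.eventually_gt_atTop 0).and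
    (eventually_rpow_le_mul (p := 1 / 16) (by norm_num)
      (by positivity : 0 < C₂ ^ k / ((2 * c₂) ^ α) ^ k))))
  refine ⟨max n₁ (max n₂ n₃), ?_⟩
  intro Ω _ P _ f X h _ hf hX hind hlaw hm hsymm hh n hn
  have hlow := hn₁ Ω P f X h hf hX hind hlaw hm hsymm (fun x y => (hh x y).1) n
    ((le_max_left _ _).trans hn)
  have h0 : ∀ x y, 0 ≤ h x y := fun x y => le_trans (by positivity) (hh x y).1
  have hup := hn₂ Ω P f X h hf hX hind hlaw hm hsymm h0 (fun x y => (hh x y).2) n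
    ((le_max_left _ _).trans ((le_max_right _ _).trans hn))
  obtain ⟨hexp, hnpos, hpow⟩ := hn₃ n ((le_max_right _ _).trans ((le_max_right _ _).trans hn))
  have hn' : (0 : ℝ) < n := by exact_mod_cast hnpos
  have hn1 : (1 : ℝ) ≤ n := by exact_mod_cast hnpos
  set N : ℝ := (n : ℝ) ^ (1 - α / 2) with hN
  have hN0 : 0 < N := by positivity
  have hmeas := measurable_mst (α := α) hX hm n
  set Z : Ω → ℝ := fun ω => mst h α (fun i => X i ω) n / N with hZ
  have hZm : Measurable Z := hmeas.div_const N
  have hZ0 : ∀ ω, 0 ≤ Z ω := fun ω => div_nonneg (mst_nonneg h0 _ _) hN0.le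
  have hZB : ∀ ω, Z ω ^ k ≤ ((2 * c₂) ^ α) ^ k * (n : ℝ) ^ (α * k / 2) := by
    intro ω
    have h1 : Z ω ≤ (2 * c₂) ^ α * (n : ℝ) ^ (α / 2) := by
      rw [hZ, div_le_iff₀ hN0, mul_assoc, hN, ← Real.rpow_add hn', add_sub_cancel, Real.rpow_one,
        mul_comm]
      exact mst_le_mul hα.le hc₂.le hsymm h0 (fun x y => (hh x y).2) _ hnpos
    refine (pow_le_pow_left₀ (hZ0 ω) h1 k).trans (le_of_eq ?_)
    rw [mul_pow, ← Real.rpow_mul_natCast hn'.le]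
    ring_nf
  have hint : Integrable (fun ω => Z ω ^ k) P := by
    refine Integrable.of_bound (hZm.pow_const k).aestronglyMeasurable
      (((2 * c₂) ^ α) ^ k * (n : ℝ) ^ (α * k / 2)) (Filter.Eventually.of_forall fun ω => ?_)
    rw [Real.norm_eq_abs, abs_of_nonneg (pow_nonneg (hZ0 ω) k)]
    exact hZB ω
  refine ⟨?_, ?_, hint, ?_, ?_⟩
  -- The bound proved has no correction, and the factor `1 - 4 * √A / n ^ (1 / 4)` is at most one.
  · refine hlow.trans (measureReal_mono fun ω hω => ?_)
    rw [Set.mem_ofPred_eq] at hω ⊢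
    refine le_trans (mul_le_of_le_one_right (by positivity) ?_) hω
    have : 0 ≤ 4 * √A / (n : ℝ) ^ (1 / 4 : ℝ) := by positivity
    linarith
  · have h1 : (n : ℝ) ^ (-(α * k / 2 + 2 * k)) ≤ 1 / (n : ℝ) ^ (2 * k) := by
      rw [one_div, ← Real.rpow_natCast, ← Real.rpow_neg hn'.le]
      refine Real.rpow_le_rpow_of_exponent_le hn1 ?_
      push_cast
      have : 0 ≤ α * k / 2 := by positivity
      linarith
    refine le_trans (by linarith) (hup.trans (measureReal_mono fun ω hω => ?_))
    rw [Set.mem_ofPred_eq] at hω ⊢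
    refine hω.trans (le_mul_of_one_le_right (by positivity) ?_)
    have : 0 ≤ 2 / (n : ℝ) ^ (1 / 16 : ℝ) := by positivity
    linarith
  · have hset : MeasurableSet {ω | C₁ * N ≤ mst h α (fun i => X i ω) n} :=
      measurableSet_le measurable_const hmeas
    have h1 : C₁ ^ k * P.real {ω | C₁ * N ≤ mst h α (fun i => X i ω) n} ≤ ∫ ω, Z ω ^ k ∂P := by
      rw [mul_comm, ← smul_eq_mul, ← integral_indicator_const _ hset]
      refine integral_mono ((integrable_const _).indicator hset) hint fun ω => ?_
      by_cases hω : ω ∈ {ω | C₁ * N ≤ mst h α (fun i => X i ω) n}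
      · rw [Set.indicator_of_mem hω]
        exact pow_le_pow_left₀ hC₁0.le ((le_div_iff₀ hN0).2 hω) k
      · rw [Set.indicator_of_notMem hω]
        exact pow_nonneg (hZ0 ω) k
    refine le_trans (mul_le_mul_of_nonneg_left (le_trans ?_ hlow) (by positivity)) h1
    -- The correction in the lower moment bound only has to absorb the failure probability `exp (-n
    -- ^ (1 / 3))`.
    rw [Real.rpow_neg hn'.le, neg_one_mul, ← div_eq_mul_inv] at hexp
    linarith
  · set bad : Set Ω := {ω | mst h α (fun i => X i ω) n ≤ C₂ * N}ᶜ with hbad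
    have hset : MeasurableSet bad := (measurableSet_le hmeas measurable_const).compl
    have hPbad : P.real bad ≤ (n : ℝ) ^ (-(α * k / 2 + 2 * k)) := by
      rw [hbad, probReal_compl_eq_one_sub (measurableSet_le hmeas measurable_const)]
      linarith
    set B : ℝ := ((2 * c₂) ^ α) ^ k * (n : ℝ) ^ (α * k / 2) with hB
    have h1 : ∫ ω, Z ω ^ k ∂P ≤ C₂ ^ k + P.real bad * B := by
      calc ∫ ω, Z ω ^ k ∂P ≤ ∫ ω, (C₂ ^ k + bad.indicator (fun _ => B) ω) ∂P := by
            refine integral_mono hint ((integrable_const _).add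
              ((integrable_const _).indicator hset)) fun ω => ?_
            by_cases hω : ω ∈ bad
            · simp only [Set.indicator_of_mem hω]
              have := hZB ω
              have : 0 ≤ C₂ ^ k := by positivity
              linarith
            · simp only [Set.indicator_of_notMem hω, add_zero]
              exact pow_le_pow_left₀ (hZ0 ω) ((div_le_iff₀ hN0).2 (not_not.1 hω)) k
        _ = C₂ ^ k + P.real bad * B := by
            rw [integral_add (integrable_const _) ((integrable_const _).indicator hset),
              integral_indicator_const _ hset]
            simp
    have h2 : P.real bad * B ≤ C₂ ^ k * (2 * k / (n : ℝ) ^ (1 / 16 : ℝ)) := by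
      have hk1 : (1 : ℝ) ≤ k := by exact_mod_cast hk
      have e1 : (n : ℝ) ^ (-(α * k / 2 + 2 * k)) * (n : ℝ) ^ (α * k / 2) ≤ (n : ℝ)⁻¹ := by
        rw [← Real.rpow_add hn', ← Real.rpow_neg_one]
        exact Real.rpow_le_rpow_of_exponent_le hn1 (by linarith)
      have e2 : ((2 * c₂) ^ α) ^ k * (n : ℝ)⁻¹ ≤ C₂ ^ k / (n : ℝ) ^ (1 / 16 : ℝ) := by
        rw [div_mul_eq_mul_div, le_div_iff₀ hB0] at hpow
        rw [← div_eq_mul_inv, div_le_div_iff₀ hn' (by positivity)]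
        linarith
      calc P.real bad * B ≤ (n : ℝ) ^ (-(α * k / 2 + 2 * k)) * B :=
            mul_le_mul_of_nonneg_right hPbad (by positivity)
        _ = ((2 * c₂) ^ α) ^ k *
              ((n : ℝ) ^ (-(α * k / 2 + 2 * k)) * (n : ℝ) ^ (α * k / 2)) := by
            rw [hB]
            ring
        _ ≤ ((2 * c₂) ^ α) ^ k * (n : ℝ)⁻¹ := mul_le_mul_of_nonneg_left e1 hB0.le
        _ ≤ C₂ ^ k / (n : ℝ) ^ (1 / 16 : ℝ) := e2
        _ ≤ C₂ ^ k / (n : ℝ) ^ (1 / 16 : ℝ) * (2 * k) :=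
            le_mul_of_one_le_right (by positivity) (by linarith)
        _ = _ := by ring
    refine h1.trans ?_
    rw [mul_add, mul_one]
    linarith
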